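/- Let $\nu>0$, let $\mathbb H$ be the algebra of quaternions, $\mathbb S=\{I\in\mathbb H: I^2=-1\}$, and for $I\in\mathbb S$ put $\mathbb C_I=\mathbb R+\mathbb R I$, with Lebesgue measure $d\lambda_I(q)=dx\,dy$ for $q=x+yI$. A real differentiable function $f:\mathbb H\to\mathbb H$ is called slice regular if for every $I\in\mathbb S$ its restriction $f_I=f|_{\mathbb C_I}$ has continuous partial derivatives in $x,y$ and satisfies $\tfrac12\left(\frac{\partial}{\partial x}+I\frac{\partial}{\partial y}\right)f_I(x+yI)=0$ for all $x,y\in\mathbb R$. For $I\in\mathbb S$ let $\mathcal F^{2,\nu}_{slice}(\mathbb H)$ be the right $\mathbb H$-vector space of all slice regular $f$ with $$\|f\|^2_{\mathcal F^{2,\nu}_{slice}(\mathbb H)}:=\int_{\mathbb C_I}|f_I(q)|^2e^{-\nu|q|^2}\,d\lambda_I(q)<\infty,$$ with inner product $\langle f,g\rangle=\int_{\mathbb C_I}\overline{g_I(q)}\,f_I(q)\,e^{-\nu|q|^2}d\lambda_I(q)$. Let $L^2(\mathbb R;\mathbb H)$ be the right $\mathbb H$-vector space of (classes of) square integrable functions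 $\mathbb R\to\mathbb H$ for Lebesgue measure, with inner product $\langle\varphi,\psi\rangle=\int_{\mathbb R}\overline{\psi(x)}\,\varphi(x)\,dx$. Set $$A(q;x)=\left(\frac{\nu}{\pi}\right)^{3/4}e^{-\frac{\nu}{2}(q^2+x^2)+\nu\sqrt2\,qx},\qquad \mathcal B_\nu(\psi)(q)=\int_{\mathbb R}A(q;x)\,\psi(x)\,dx\qquad(q\in\mathbb H,\ x\in\mathbb R).$$ **Theorem.** For every choice of $I\in\mathbb S$ the following holds. The integral $\mathcal B_\nu(\psi)(q)$ converges absolutely for all $\psi\in L^2(\mathbb R;\mathbb H)$ and $q\in\mathbb H$, and $\mathcal B_\nu$ is a right $\mathbb H$-linear surjective isometry from $L^2(\mathbb R;\mathbb H)$ onto $\mathcal F^{2,\nu}_{slice}(\mathbb H)$: it is a bijection of $L^2(\mathbb R;\mathbb H)$ onto $\mathcal F^{2,\nu}_{slice}(\mathbb H)$ that preserves norms and inner products. -/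

import Mathlib

open MeasureTheory
open scoped Quaternion

noncomputable section

namespace QuaternionicSegalBargmann

/-- The restriction `f_I` of `f` to the slice `ℂ_I = ℝ + ℝ I`, read in the real coordinates
`(x, y)` of `q = x + y I`. -/
def sliceFun (f : ℍ → ℍ) (I : ℍ) (p : ℝ × ℝ) : ℍ :=
  f ((p.1 : ℍ) + (p.2 : ℍ) * I)

/-- The slice Cauchy-Riemann operator
`∂̄_I f (x + I y) = 1/2 (∂/∂x + I ∂/∂y) f_I (x + y I)`. -/
def dbar (I : ℍ) (f : ℍ → ℍ) (x y : ℝ) : ℍ :=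
  (1 / 2 : ℝ) • (deriv (fun s : ℝ => sliceFun f I (s, y)) x
    + I * deriv (fun t : ℝ => sliceFun f I (x, t)) y)

/-- Slice (left) regular functions on the whole of `ℍ`: real differentiable functions whose
restriction to every slice `ℝ + ℝ I`, `I² = -1`, is of class `C¹` and is annihilated
by `∂̄_I`. -/
structure SliceRegular (f : ℍ → ℍ) : Prop where
  differentiable : Differentiable ℝ f
  contDiff_slice : ∀ I : ℍ, I ^ 2 = -1 → ContDiff ℝ 1 (sliceFun f I)
  dbar_eq_zero : ∀ I : ℍ, I ^ 2 = -1 → ∀ x y : ℝ, dbar I f x y = 0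

/-- The Gaussian weight `exp (-ν |q|²)` at `q = x + y I`. -/
def weight (ν : ℝ) (I : ℍ) (p : ℝ × ℝ) : ℝ :=
  Real.exp (-ν * ‖(p.1 : ℍ) + (p.2 : ℍ) * I‖ ^ 2)

theorem continuous_slicePoint (I : ℍ) :
    Continuous fun p : ℝ × ℝ => (p.1 : ℍ) + (p.2 : ℍ) * I :=
  (Quaternion.continuous_coe.comp continuous_fst).add
    ((Quaternion.continuous_coe.comp continuous_snd).mul continuous_const)

theorem continuous_weight (ν : ℝ) (I : ℍ) : Continuous (weight ν I) :=
  Real.continuous_exp.comp (continuous_const.mul ((continuous_slicePoint I).norm.pow 2))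

theorem SliceRegular.continuous_slice {f : ℍ → ℍ} (hf : SliceRegular f) (I : ℍ) :
    Continuous (sliceFun f I) :=
  hf.differentiable.continuous.comp (continuous_slicePoint I)

theorem SliceRegular.diff_left {f : ℍ → ℍ} (hf : SliceRegular f) {I : ℍ} (hI : I ^ 2 = -1)
    (x y : ℝ) : DifferentiableAt ℝ (fun s : ℝ => sliceFun f I (s, y)) x :=
  DifferentiableAt.comp (g := sliceFun f I) x
    (((hf.contDiff_slice I hI).differentiable one_ne_zero) (x, y))
    (differentiableAt_id.prodMk (differentiableAt_const y))

theorem SliceRegular.diff_right {f : ℍ → ℍ} (hf : SliceRegular f) {I : ℍ} (hI : I ^ 2 = -1)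
    (x y : ℝ) : DifferentiableAt ℝ (fun t : ℝ => sliceFun f I (x, t)) y :=
  DifferentiableAt.comp (g := sliceFun f I) y
    (((hf.contDiff_slice I hI).differentiable one_ne_zero) (x, y))
    ((differentiableAt_const x).prodMk differentiableAt_id)

theorem SliceRegular.zero : SliceRegular (0 : ℍ → ℍ) where
  differentiable := differentiable_const 0
  contDiff_slice _ _ := contDiff_const
  dbar_eq_zero I _ x y := by simp [dbar, sliceFun]

theorem SliceRegular.add {f g : ℍ → ℍ} (hf : SliceRegular f) (hg : SliceRegular g) :
    SliceRegular (f + g) where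
  differentiable := hf.differentiable.add hg.differentiable
  contDiff_slice I hI := (hf.contDiff_slice I hI).add (hg.contDiff_slice I hI)
  dbar_eq_zero I hI x y := by
    have h1 := deriv_fun_add (hf.diff_left hI x y) (hg.diff_left hI x y)
    have h2 := deriv_fun_add (hf.diff_right hI x y) (hg.diff_right hI x y)
    have h3 := hf.dbar_eq_zero I hI x y
    have h4 := hg.dbar_eq_zero I hI x y
    have h5 : dbar I (f + g) x y = dbar I f x y + dbar I g x y := by
      unfold dbar
      rw [← smul_add]
      congr 1
      calc _ = (deriv (fun s : ℝ => sliceFun f I (s, y)) x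
              + deriv (fun s : ℝ => sliceFun g I (s, y)) x)
            + I * (deriv (fun t : ℝ => sliceFun f I (x, t)) y
              + deriv (fun t : ℝ => sliceFun g I (x, t)) y) := by rw [← h1, ← h2]; rfl
        _ = _ := by rw [mul_add]; abel
    rw [h5, h3, h4, add_zero]

theorem SliceRegular.mul_const {f : ℍ → ℍ} (hf : SliceRegular f) (c : ℍ) :
    SliceRegular (fun q => f q * c) where
  differentiable := hf.differentiable.mul_const c
  contDiff_slice I hI := (hf.contDiff_slice I hI).mul contDiff_const
  dbar_eq_zero I hI x y := by
    have h1 := deriv_mul_const (hf.diff_left hI x y) c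
    have h2 := deriv_mul_const (hf.diff_right hI x y) c
    have h3 := hf.dbar_eq_zero I hI x y
    have h5 : dbar I (fun q => f q * c) x y = dbar I f x y * c := by
      unfold dbar
      rw [smul_mul_assoc, add_mul, mul_assoc, ← h1, ← h2]
      rfl
    rw [h5, h3, zero_mul]

/-- The slice hyperholomorphic Bargmann-Fock space, computed on the slice `ℂ_I`: the slice
regular functions `f` on `ℍ` with `∫_{ℂ_I} |f_I(q)|² exp (-ν |q|²) dλ_I(q) < ∞`, as a right
vector space over `ℍ` (that is, a left vector space over `ℍᵐᵒᵖ`). -/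
def fockSpace (ν : ℝ) (I : ℍ) : Submodule ℍᵐᵒᵖ (ℍ → ℍ) where
  carrier := {f | SliceRegular f ∧
    Integrable (fun p : ℝ × ℝ => ‖sliceFun f I p‖ ^ 2 * weight ν I p)}
  zero_mem' := ⟨SliceRegular.zero, by simp [sliceFun]⟩
  add_mem' := by
    rintro f g ⟨hf, hf'⟩ ⟨hg, hg'⟩
    refine ⟨hf.add hg, ((hf'.add hg').const_mul 2).mono'
      ((((hf.add hg).continuous_slice I).norm.pow 2).mul
        (continuous_weight ν I)).aestronglyMeasurable (Filter.Eventually.of_forall fun p => ?_)⟩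
    have hw : 0 ≤ weight ν I p := (Real.exp_pos _).le
    rw [Real.norm_of_nonneg (mul_nonneg (sq_nonneg _) hw)]
    have h1 : ‖sliceFun (f + g) I p‖ ≤ ‖sliceFun f I p‖ + ‖sliceFun g I p‖ := norm_add_le _ _
    have h2 : ‖sliceFun (f + g) I p‖ ^ 2
        ≤ 2 * (‖sliceFun f I p‖ ^ 2 + ‖sliceFun g I p‖ ^ 2) := by
      nlinarith [norm_nonneg (sliceFun (f + g) I p),
        sq_nonneg (‖sliceFun f I p‖ - ‖sliceFun g I p‖)]
    calc _ ≤ 2 * (‖sliceFun f I p‖ ^ 2 + ‖sliceFun g I p‖ ^ 2) * weight ν I p :=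
          mul_le_mul_of_nonneg_right h2 hw
      _ = _ := by simp only [Pi.add_apply]; ring
  smul_mem' := by
    rintro c f ⟨hf, hf'⟩
    refine ⟨hf.mul_const c.unop, (hf'.const_mul (‖c.unop‖ ^ 2)).congr
      (Filter.Eventually.of_forall fun p => ?_)⟩
    have h : sliceFun (c • f) I p = sliceFun f I p * c.unop := rfl
    simp only [h, norm_mul]
    ring

/-- The inner product `⟨f, g⟩ = ∫_{ℂ_I} conj (g_I(q)) f_I(q) exp (-ν |q|²) dλ_I(q)`. -/
def fockInner (ν : ℝ) (I : ℍ) (f g : ℍ → ℍ) : ℍ :=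
  ∫ p : ℝ × ℝ, weight ν I p • (star (sliceFun g I p) * sliceFun f I p)

/-- The norm `‖f‖ = (∫_{ℂ_I} |f_I(q)|² exp (-ν |q|²) dλ_I(q))^{1/2}`. -/
def fockNorm (ν : ℝ) (I : ℍ) (f : ℍ → ℍ) : ℝ :=
  Real.sqrt (∫ p : ℝ × ℝ, ‖sliceFun f I p‖ ^ 2 * weight ν I p)

/-- The kernel `A(q; x) = (ν/π)^{3/4} exp (-ν/2 (q² + x²) + ν √2 q x)`. -/
def kernel (ν : ℝ) (q : ℍ) (x : ℝ) : ℍ :=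
  ((ν / Real.pi) ^ (3 / 4 : ℝ) : ℝ) •
    NormedSpace.exp ((-ν / 2 : ℝ) • (q ^ 2 + (x : ℍ) ^ 2) + (ν * √2 : ℝ) • (q * (x : ℍ)))

/-- The quaternionic Segal-Bargmann transform `B_ν ψ (q) = ∫_ℝ A(q; x) ψ(x) dx`. -/
def transform (ν : ℝ) (ψ : ℝ → ℍ) (q : ℍ) : ℍ :=
  ∫ x : ℝ, kernel ν q x * ψ x

end QuaternionicSegalBargmann

end

/-!
Left multiplication by the elements of a slice `ℂ_I` makes `ℍ` a complex Hilbert space, in which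
slice regularity on `ℂ_I` is holomorphy and `B_ν` is the Segal-Bargmann transform of functions with
values in a complex Hilbert space.

On the vertical line `Re z = u` that transform is, up to a phase and the factor `exp (ν |z|² / 2)`,
the rescaled Fourier transform of `x ↦ exp (-ν/2 (x - √2 u)²) ψ x`, so that Plancherel's theorem
and Tonelli's theorem give the isometry. Its range is therefore closed. It contains the reproducing
kernels `z ↦ exp (ν z w̄) c`, which are the images of the conjugated kernels, and hence an entire
function orthogonal to the range vanishes at every point: the transform is onto.

A slice regular function is determined by its values on `ℝ`, by the identity theorem on each slice,
which brings surjectivity back to `ℍ`. The `ℍ`-valued inner products are preserved because, by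
polarization, they are determined by the norms of all the functions `f + g c` with `c ∈ ℍ`.
-/

open scoped FourierTransform ENNReal

namespace QuaternionicSegalBargmann

section Plancherel

open scoped SchwartzMap

variable {V E : Type*} [NormedAddCommGroup V] [InnerProductSpace ℝ V] [FiniteDimensional ℝ V]
  [MeasurableSpace V] [BorelSpace V]
  [NormedAddCommGroup E] [InnerProductSpace ℂ E] [CompleteSpace E]

-- Both sides define the same tempered distribution, and are locally integrable.
theorem fourier_toLp_ae_eq {f : V → E} (h1 : Integrable f) (h2 : MemLp f 2) :
    ((𝓕 (h2.toLp f) : Lp (α := V) E 2) : V → E) =ᵐ[volume] 𝓕 f := by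
  have hcont : Continuous (𝓕 f) :=
    VectorFourier.fourierIntegral_continuous Real.continuous_fourierChar
      (by exact continuous_inner) h1
  refine ae_eq_of_integral_contDiff_smul_eq
    ((Lp.memLp _).locallyIntegrable (by norm_num)) hcont.locallyIntegrable
    fun g hg hgs => ?_
  have hgc : HasCompactSupport fun x => (g x : ℂ) := hgs.comp_left (g := Complex.ofReal) rfl
  set G : 𝓢(V, ℂ) := hgc.toSchwartzMap (Complex.ofRealCLM.contDiff.comp hg)
  have hG (h : V → E) : ∫ x, g x • h x = ∫ x, G x • h x :=
    integral_congr_ae (.of_forall fun x => (Complex.coe_smul (g x) (h x)).symm)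
  have hpair : ∫ x, 𝓕 G x • (h2.toLp f : V → E) x
      = ∫ x, G x • (𝓕 (h2.toLp f) : Lp (α := V) E 2 volume) x := by
    simpa only [TemperedDistribution.fourier_apply, Lp.toTemperedDistribution_apply]
      using congrArg (fun T => T G) (Lp.fourier_toTemperedDistribution_eq (h2.toLp f))
  calc ∫ x, g x • (𝓕 (h2.toLp f) : Lp (α := V) E 2 volume) x
      = ∫ x, 𝓕 G x • (h2.toLp f : V → E) x := by rw [hG, hpair]
    _ = ∫ x, 𝓕 G x • f x := integral_congr_ae (by
        filter_upwards [h2.coeFn_toLp] with x hx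
        rw [hx])
    _ = ∫ x, G x • 𝓕 f x := by
        simpa using! VectorFourier.integral_fourierIntegral_smul_eq_flip (L := innerₗ V)
          Real.continuous_fourierChar continuous_inner G.integrable h1
    _ = ∫ x, g x • 𝓕 f x := (hG _).symm

theorem eLpNorm_fourier_two {f : V → E} (h1 : Integrable f) (h2 : MemLp f 2) :
    eLpNorm (𝓕 f) 2 = eLpNorm f 2 := by
  have h := Lp.norm_fourier_eq (h2.toLp f)
  rwa [Lp.norm_toLp, Lp.norm_def,
    ENNReal.toReal_eq_toReal_iff' (Lp.eLpNorm_ne_top _) h2.eLpNorm_ne_top,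
    eLpNorm_congr_ae (fourier_toLp_ae_eq h1 h2)] at h

end Plancherel

section ExponentialBounds

open scoped Nat

variable {𝔸 : Type*} [NormedRing 𝔸] [NormOneClass 𝔸]

theorem norm_pow_succ_sub_pow_succ_le {a b : 𝔸} {R : ℝ} (ha : ‖a‖ ≤ R) (hb : ‖b‖ ≤ R) (n : ℕ) :
    ‖a ^ (n + 1) - b ^ (n + 1)‖ ≤ (n + 1) * R ^ n * ‖a - b‖ := by
  have hR : 0 ≤ R := (norm_nonneg a).trans ha
  induction n with
  | zero => simp
  | succ n ih =>
    have telescope : a ^ (n + 2) - b ^ (n + 2)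
        = a * (a ^ (n + 1) - b ^ (n + 1)) + (a - b) * b ^ (n + 1) := by
      rw [pow_succ' a (n + 1), pow_succ' b (n + 1)]; noncomm_ring
    have hbn : ‖b ^ (n + 1)‖ ≤ R ^ (n + 1) :=
      (norm_pow_le b _).trans (pow_le_pow_left₀ (norm_nonneg b) hb _)
    calc ‖a ^ (n + 2) - b ^ (n + 2)‖
        ≤ ‖a‖ * ‖a ^ (n + 1) - b ^ (n + 1)‖ + ‖a - b‖ * ‖b ^ (n + 1)‖ := by
          rw [telescope]
          exact (norm_add_le _ _).trans (add_le_add (norm_mul_le _ _) (norm_mul_le _ _))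
      _ ≤ R * ((n + 1) * R ^ n * ‖a - b‖) + ‖a - b‖ * R ^ (n + 1) := by gcongr
      _ = ((n + 1 : ℕ) + 1) * R ^ (n + 1) * ‖a - b‖ := by push_cast; ring

variable [NormedAlgebra ℝ 𝔸]

theorem norm_smul_sq_add_smul_le (s t : ℝ) {a : 𝔸} {R : ℝ} (ha : ‖a‖ ≤ R) :
    ‖s • a ^ 2 + t • a‖ ≤ |s| * R ^ 2 + |t| * R := by
  refine (norm_add_le _ _).trans ?_
  rw [norm_smul, norm_smul, Real.norm_eq_abs, Real.norm_eq_abs]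
  gcongr
  exact (norm_pow_le a 2).trans (by gcongr)

variable [CompleteSpace 𝔸]

theorem norm_exp_le (a : 𝔸) : ‖NormedSpace.exp a‖ ≤ Real.exp ‖a‖ := by
  have hexp : HasSum (fun n : ℕ => ‖a‖ ^ n / n !) (Real.exp ‖a‖) := by
    rw [Real.exp_eq_exp_ℝ]
    exact NormedSpace.expSeries_div_hasSum_exp ‖a‖
  refine (NormedSpace.exp_series_hasSum_exp' (𝕂 := ℝ) a).norm_le_of_bounded hexp fun n => ?_
  rw [norm_smul, norm_inv, RCLike.norm_natCast, div_eq_inv_mul]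
  gcongr
  exact norm_pow_le a n

theorem norm_exp_sub_exp_le {a b : 𝔸} {R : ℝ} (ha : ‖a‖ ≤ R) (hb : ‖b‖ ≤ R) :
    ‖NormedSpace.exp a - NormedSpace.exp b‖ ≤ Real.exp R * ‖a - b‖ := by
  have hsum : HasSum (fun n : ℕ => (n ! : ℝ)⁻¹ • (a ^ n - b ^ n))
      (NormedSpace.exp a - NormedSpace.exp b) := by
    simp only [smul_sub]
    exact (NormedSpace.exp_series_hasSum_exp' (𝕂 := ℝ) a).sub
      (NormedSpace.exp_series_hasSum_exp' (𝕂 := ℝ) b)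
  have hsum_succ := (hasSum_nat_add_iff' 1).mpr hsum
  simp only [Finset.range_one, Finset.sum_singleton, pow_zero, sub_self, smul_zero, sub_zero]
    at hsum_succ
  have hexp : HasSum (fun n : ℕ => R ^ n / n ! * ‖a - b‖) (Real.exp R * ‖a - b‖) := by
    rw [Real.exp_eq_exp_ℝ]
    exact (NormedSpace.expSeries_div_hasSum_exp R).mul_right _
  refine hsum_succ.norm_le_of_bounded hexp fun n => ?_
  rw [norm_smul, norm_inv, RCLike.norm_natCast, Nat.factorial_succ]
  calc _ ≤ (((n + 1) * n ! : ℕ) : ℝ)⁻¹ * ((n + 1) * R ^ n * ‖a - b‖) := by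
        gcongr; exact norm_pow_succ_sub_pow_succ_le ha hb n
    _ = _ := by push_cast; field_simp

theorem norm_exp_smul_sq_add_smul_sub_le (s t : ℝ) {a b : 𝔸} {R : ℝ} (ha : ‖a‖ ≤ R)
    (hb : ‖b‖ ≤ R) :
    ‖NormedSpace.exp (s • a ^ 2 + t • a) - NormedSpace.exp (s • b ^ 2 + t • b)‖
      ≤ Real.exp (|s| * R ^ 2 + |t| * R) * ((2 * |s| * R + |t|) * ‖a - b‖) := by
  have hpow : ‖a ^ 2 - b ^ 2‖ ≤ 2 * R * ‖a - b‖ := by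
    simpa [one_add_one_eq_two] using norm_pow_succ_sub_pow_succ_le ha hb 1
  refine (norm_exp_sub_exp_le (norm_smul_sq_add_smul_le s t ha)
    (norm_smul_sq_add_smul_le s t hb)).trans ?_
  gcongr
  calc ‖s • a ^ 2 + t • a - (s • b ^ 2 + t • b)‖
      = ‖s • (a ^ 2 - b ^ 2) + t • (a - b)‖ := by simp only [smul_sub]; abel_nf
    _ ≤ |s| * ‖a ^ 2 - b ^ 2‖ + |t| * ‖a - b‖ := by
        refine (norm_add_le _ _).trans_eq ?_
        rw [norm_smul, norm_smul, Real.norm_eq_abs, Real.norm_eq_abs]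
    _ ≤ |s| * (2 * R * ‖a - b‖) + |t| * ‖a - b‖ := by gcongr
    _ = _ := by ring

end ExponentialBounds

section ExponentialIntegrals

variable {𝔸 M α : Type*} [NormedRing 𝔸] [NormedAlgebra ℝ 𝔸] [CompleteSpace 𝔸]
  [NormedAddCommGroup M] [Module 𝔸 M] [IsBoundedSMul 𝔸 M]
  [MeasurableSpace α] {μ : Measure α}

theorem contDiff_exp_smul_sq_add_smul (𝕜 : Type*) [RCLike 𝕜] [NormedAlgebra 𝕜 𝔸]
    [IsScalarTower ℝ 𝕜 𝔸] (s : ℝ) :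
    ContDiff 𝕜 1 fun p : 𝕜 × 𝔸 => NormedSpace.exp (s • p.2 ^ 2 + p.1 • p.2) := by
  have hexp : ContDiff 𝕜 1 (NormedSpace.exp : 𝔸 → 𝔸) :=
    contDiff_iff_contDiffAt.mpr fun a => (NormedSpace.exp_analytic (𝕂 := 𝕜) a).contDiffAt
  simp only [RCLike.real_smul_eq_coe_smul (K := 𝕜) s]
  exact hexp.comp (by fun_prop)

theorem aestronglyMeasurable_exp_smul (s : ℝ) {τ : α → ℝ} (hτ : AEMeasurable τ μ) {g : α → M}
    (hg : AEStronglyMeasurable g μ) (a : 𝔸) :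
    AEStronglyMeasurable (fun x => NormedSpace.exp (s • a ^ 2 + τ x • a) • g x) μ := by
  let _ : NormedAlgebra ℚ 𝔸 := .restrictScalars ℚ ℝ 𝔸
  have hexp : Continuous fun t : ℝ => NormedSpace.exp (s • a ^ 2 + t • a) :=
    NormedSpace.exp_continuous.comp (by fun_prop)
  exact (hexp.comp_aestronglyMeasurable hτ.aestronglyMeasurable).smul hg

variable [NormOneClass 𝔸]

theorem integrable_exp_smul (s : ℝ) {τ : α → ℝ} (hτ : AEMeasurable τ μ) {g : α → M}
    (hg : AEStronglyMeasurable g μ)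
    (hint : ∀ r : ℝ, Integrable (fun x => Real.exp (r * |τ x|) * ‖g x‖) μ) (a : 𝔸) :
    Integrable (fun x => NormedSpace.exp (s • a ^ 2 + τ x • a) • g x) μ := by
  refine ((hint ‖a‖).const_mul (Real.exp (|s| * ‖a‖ ^ 2))).mono'
    (aestronglyMeasurable_exp_smul s hτ hg a) (.of_forall fun x => ?_)
  calc ‖NormedSpace.exp (s • a ^ 2 + τ x • a) • g x‖
      ≤ Real.exp (|s| * ‖a‖ ^ 2 + |τ x| * ‖a‖) * ‖g x‖ := by
        refine (norm_smul_le _ _).trans ?_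
        gcongr
        exact (norm_exp_le _).trans (Real.exp_le_exp.mpr (norm_smul_sq_add_smul_le s _ le_rfl))
    _ = _ := by rw [Real.exp_add, mul_comm |τ x|]; ring

theorem norm_exp_smul_sub_exp_smul_le (s t : ℝ) {a b : 𝔸} {R : ℝ} (ha : ‖a‖ ≤ R) (hb : ‖b‖ ≤ R)
    (v : M) :
    ‖NormedSpace.exp (s • a ^ 2 + t • a) • v - NormedSpace.exp (s • b ^ 2 + t • b) • v‖
      ≤ (2 * |s| * R + 1) * Real.exp (|s| * R ^ 2) * (Real.exp ((R + 1) * |t|) * ‖v‖)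
        * ‖a - b‖ := by
  have hR : 0 ≤ R := (norm_nonneg a).trans ha
  have hlin : 2 * |s| * R + |t| ≤ (2 * |s| * R + 1) * Real.exp |t| := by
    nlinarith [Real.add_one_le_exp |t|, abs_nonneg t, mul_nonneg (abs_nonneg s) hR]
  rw [← sub_smul]
  calc ‖(NormedSpace.exp (s • a ^ 2 + t • a) - NormedSpace.exp (s • b ^ 2 + t • b)) • v‖
      ≤ Real.exp (|s| * R ^ 2 + |t| * R) * ((2 * |s| * R + 1) * Real.exp |t| * ‖a - b‖)
          * ‖v‖ := by
        refine (norm_smul_le _ _).trans ?_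
        gcongr
        exact (norm_exp_smul_sq_add_smul_sub_le s t ha hb).trans (by gcongr)
    _ = _ := by rw [add_mul R, Real.exp_add, Real.exp_add, one_mul, mul_comm |t|]; ring

variable (𝕜 : Type*) [RCLike 𝕜] [NormedAlgebra 𝕜 𝔸] [IsScalarTower ℝ 𝕜 𝔸]
  [NormedSpace ℝ M] [NormedSpace 𝕜 M] [IsScalarTower 𝕜 𝔸 M]

theorem differentiable_integral_exp_smul (s : ℝ) {τ : α → ℝ} (hτ : AEMeasurable τ μ) {g : α → M}
    (hg : AEStronglyMeasurable g μ)
    (hint : ∀ r : ℝ, Integrable (fun x => Real.exp (r * |τ x|) * ‖g x‖) μ) :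
    Differentiable 𝕜 fun a : 𝔸 => ∫ x, NormedSpace.exp (s • a ^ 2 + τ x • a) • g x ∂μ := by
  intro a
  have hcd := contDiff_exp_smul_sq_add_smul (𝔸 := 𝔸) 𝕜 s
  let D (t : ℝ) : 𝔸 →L[𝕜] 𝔸 :=
    fderiv 𝕜 (fun b : 𝔸 => NormedSpace.exp (s • b ^ 2 + (t : 𝕜) • b)) a
  have hDcont : Continuous D := (Continuous.fderiv (n := 1) (g := fun _ : 𝕜 => a)
    (f := fun (t : 𝕜) (b : 𝔸) => NormedSpace.exp (s • b ^ 2 + t • b)) hcd continuous_const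
    le_rfl).comp RCLike.continuous_ofReal
  have hD (t : ℝ) : HasFDerivAt (fun b : 𝔸 => NormedSpace.exp (s • b ^ 2 + t • b)) (D t) a := by
    simp only [RCLike.real_smul_eq_coe_smul (K := 𝕜) t]
    exact ((hcd.comp (contDiff_prodMk_right (t : 𝕜))).differentiable one_ne_zero a).hasFDerivAt
  let L := ContinuousLinearMap.lsmul 𝕜 𝔸 (E := M)
  refine (hasFDerivAt_integral_of_dominated_loc_of_lip' (𝕜 := 𝕜)
    (F' := fun x => (L.flip (g x)).comp (D (τ x))) (Metric.ball_mem_nhds a one_pos)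
    (fun b _ => aestronglyMeasurable_exp_smul s hτ hg b) (integrable_exp_smul s hτ hg hint a)
    ?_ (.of_forall fun x b hb => norm_exp_smul_sub_exp_smul_le s (τ x) (R := ‖a‖ + 1) ?_ ?_ (g x))
    ((hint _).const_mul _) (.of_forall fun x => ?_)).2.differentiableAt
  · exact (ContinuousLinearMap.compL 𝕜 𝔸 𝔸 M).aestronglyMeasurable_comp₂
      (L.flip.continuous.comp_aestronglyMeasurable hg)
      (hDcont.comp_aestronglyMeasurable hτ.aestronglyMeasurable)
  · rw [Metric.mem_ball, dist_eq_norm] at hb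
    linarith [norm_sub_norm_le b a]
  · linarith
  · exact (L.flip (g x)).hasFDerivAt.comp a (hD (τ x))

end ExponentialIntegrals

section GaussianDecay

theorem memLp_exp_quadratic {b : ℝ} (hb : 0 < b) (c : ℝ) :
    MemLp (fun x : ℝ => Real.exp (-b * x ^ 2 + c * x)) 2 := by
  rw [memLp_two_iff_integrable_sq (by fun_prop)]
  refine (integrable_cexp_quadratic (b := (2 * b : ℝ)) (by simpa using hb)
    ((2 * c : ℝ) : ℂ) 0).norm.congr (.of_forall fun x => ?_)
  simp only [Complex.norm_exp]
  rw [← Real.exp_nat_mul]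
  congr 1
  simp [pow_two]
  ring

theorem memLp_exp_mul_abs_mul_gaussian {b : ℝ} (hb : 0 < b) (t : ℝ) :
    MemLp (fun x : ℝ => Real.exp (t * |x|) * Real.exp (-b * x ^ 2)) 2 := by
  refine ((memLp_exp_quadratic hb t).add (memLp_exp_quadratic hb (-t))).mono
    (by fun_prop) (.of_forall fun x => ?_)
  rw [Real.norm_of_nonneg (by positivity), Pi.add_apply, Real.norm_of_nonneg (by positivity),
    ← Real.exp_add]
  rcases abs_cases x with ⟨h, _⟩ | ⟨h, _⟩ <;> rw [h]
  · rw [add_comm (t * x)]; exact le_add_of_nonneg_right (Real.exp_pos _).le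
  · rw [mul_neg, ← neg_mul, add_comm (-t * x)]
    exact le_add_of_nonneg_left (Real.exp_pos _).le

variable {E : Type*} [NormedAddCommGroup E] [NormedSpace ℝ E] {b : ℝ} {ψ : ℝ → E}

theorem integrable_exp_mul_abs_mul_norm_gaussian_smul (hb : 0 < b) (hψ : MemLp ψ 2) (t : ℝ) :
    Integrable fun x => Real.exp (t * |x|) * ‖Real.exp (-b * x ^ 2) • ψ x‖ := by
  refine ((memLp_exp_mul_abs_mul_gaussian hb t).integrable_mul hψ.norm).congr
    (.of_forall fun x => ?_)
  simp only [Pi.mul_apply, norm_smul, Real.norm_of_nonneg (Real.exp_pos _).le, mul_assoc]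

theorem integrable_gaussian_sub_smul (hb : 0 < b) (hψ : MemLp ψ 2) (c : ℝ) :
    Integrable fun x : ℝ => Real.exp (-b * (x - c) ^ 2) • ψ x := by
  have hgaussian : MemLp (fun x : ℝ => Real.exp (-b * (x - c) ^ 2)) 2 := by
    simpa using! (memLp_exp_quadratic hb 0).comp_measurePreserving
      (measurePreserving_sub_right volume c)
  exact memLp_one_iff_integrable.mp (hψ.smul (r := 1) hgaussian :)

theorem memLp_gaussian_sub_smul (hb : 0 ≤ b) (hψ : MemLp ψ 2) (c : ℝ) :
    MemLp (fun x : ℝ => Real.exp (-b * (x - c) ^ 2) • ψ x) 2 := by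
  refine hψ.mono ((by fun_prop : Continuous fun x : ℝ =>
    Real.exp (-b * (x - c) ^ 2)).aestronglyMeasurable.smul hψ.1) (.of_forall fun x => ?_)
  rw [norm_smul, Real.norm_of_nonneg (Real.exp_pos _).le]
  refine mul_le_of_le_one_left (norm_nonneg _) (Real.exp_le_one_iff.mpr ?_)
  nlinarith [sq_nonneg (x - c)]

end GaussianDecay

section Transform

variable {𝔸 M : Type*} [NormedRing 𝔸] [NormedAlgebra ℝ 𝔸]

/-- The Segal-Bargmann kernel with the variable `a` in a real Banach algebra. For the quaternions
it is `kernel`, for the complex numbers the classical kernel; both are needed, and the estimates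
are the same. -/
noncomputable def bargmannKernel (ν : ℝ) (a : 𝔸) (x : ℝ) : 𝔸 :=
  ((ν / Real.pi) ^ (3 / 4 : ℝ) : ℝ) •
    NormedSpace.exp ((-ν / 2 : ℝ) • (a ^ 2 + (algebraMap ℝ 𝔸 x) ^ 2)
      + (ν * √2 : ℝ) • (a * algebraMap ℝ 𝔸 x))

/-- The Segal-Bargmann transform of a function with values in an `𝔸`-module, as a function on the
Banach algebra `𝔸`. -/
noncomputable def bargmannTransform [NormedAddCommGroup M] [NormedSpace ℝ M] [Module 𝔸 M] (ν : ℝ)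
    (ψ : ℝ → M) (a : 𝔸) : M :=
  ∫ x : ℝ, bargmannKernel ν a x • ψ x

theorem bargmannKernel_eq [CompleteSpace 𝔸] (ν : ℝ) (a : 𝔸) (x : ℝ) :
    bargmannKernel ν a x = ((ν / Real.pi) ^ (3 / 4 : ℝ) * Real.exp (-(ν / 2) * x ^ 2)) •
      NormedSpace.exp ((-ν / 2) • a ^ 2 + (ν * √2 * x) • a) := by
  let _ : NormedAlgebra ℚ 𝔸 := .restrictScalars ℚ ℝ 𝔸
  have hexponent : (-ν / 2 : ℝ) • (a ^ 2 + (algebraMap ℝ 𝔸 x) ^ 2)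
        + (ν * √2 : ℝ) • (a * algebraMap ℝ 𝔸 x)
      = algebraMap ℝ 𝔸 (-(ν / 2) * x ^ 2) + ((-ν / 2) • a ^ 2 + (ν * √2 * x) • a) := by
    rw [← map_pow, Algebra.algebraMap_eq_smul_one, Algebra.algebraMap_eq_smul_one,
      Algebra.algebraMap_eq_smul_one, mul_smul_one]
    module
  rw [bargmannKernel, hexponent, NormedSpace.exp_add_of_commute (Algebra.commutes _ _),
    ← NormedSpace.algebraMap_exp_comm, ← Real.exp_eq_exp_ℝ, ← Algebra.smul_def, smul_smul]

theorem map_bargmannKernel [CompleteSpace 𝔸] {𝔹 : Type*} [NormedRing 𝔹] [NormedAlgebra ℝ 𝔹]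
    (φ : 𝔸 →ₐ[ℝ] 𝔹) (hφ : Continuous φ) (ν : ℝ) (a : 𝔸) (x : ℝ) :
    φ (bargmannKernel ν a x) = bargmannKernel ν (φ a) x := by
  let _ : NormedAlgebra ℚ 𝔸 := .restrictScalars ℚ ℝ 𝔸
  let _ : NormedAlgebra ℚ 𝔹 := .restrictScalars ℚ ℝ 𝔹
  simp only [bargmannKernel, map_smul, NormedSpace.map_exp φ hφ, map_add, map_mul, map_pow,
    AlgHom.commutes]

theorem continuous_bargmannKernel [CompleteSpace 𝔸] (ν : ℝ) (a : 𝔸) :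
    Continuous (bargmannKernel ν a) := by
  let _ : NormedAlgebra ℚ 𝔸 := .restrictScalars ℚ ℝ 𝔸
  have := algebraMapCLM ℝ 𝔸 |>.continuous
  exact (NormedSpace.exp_continuous.comp (by fun_prop)).const_smul _

variable [NormedAddCommGroup M] [NormedSpace ℝ M] [Module 𝔸 M]

theorem bargmannTransform_congr_ae {ψ φ : ℝ → M} (h : ψ =ᵐ[volume] φ) (ν : ℝ) (a : 𝔸) :
    bargmannTransform ν ψ a = bargmannTransform ν φ a :=
  integral_congr_ae (h.mono fun x hx => congrArg (bargmannKernel ν a x • ·) hx)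

variable [CompleteSpace 𝔸] [IsScalarTower ℝ 𝔸 M]

theorem bargmannKernel_smul_eq (ν : ℝ) (a : 𝔸) (x : ℝ) (v : M) :
    bargmannKernel ν a x • v = ((ν / Real.pi) ^ (3 / 4 : ℝ) : ℝ) •
      NormedSpace.exp ((-ν / 2) • a ^ 2 + (ν * √2 * x) • a) • Real.exp (-(ν / 2) * x ^ 2) • v := by
  have := IsScalarTower.to_smulCommClass (R := ℝ) (A := 𝔸) (M := M)
  rw [bargmannKernel_eq, smul_assoc, mul_smul, smul_comm (Real.exp _)]

variable [NormOneClass 𝔸] [IsBoundedSMul 𝔸 M] {ν : ℝ} {ψ φ : ℝ → M}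

theorem integrable_exp_mul_abs_gaussian_smul (hν : 0 < ν) (hψ : MemLp ψ 2) (r : ℝ) :
    Integrable fun x => Real.exp (r * |ν * √2 * x|) * ‖Real.exp (-(ν / 2) * x ^ 2) • ψ x‖ := by
  simpa only [abs_mul (ν * √2), mul_assoc r] using
    integrable_exp_mul_abs_mul_norm_gaussian_smul (half_pos hν) hψ (r * |ν * √2|)

theorem integrable_bargmannKernel_smul (hν : 0 < ν) (hψ : MemLp ψ 2) (a : 𝔸) :
    Integrable fun x => bargmannKernel ν a x • ψ x := by
  simp only [bargmannKernel_smul_eq]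
  exact (integrable_exp_smul _ (by fun_prop)
    ((by fun_prop : Continuous fun x : ℝ => Real.exp (-(ν / 2) * x ^ 2)).aestronglyMeasurable.smul
      hψ.1) (integrable_exp_mul_abs_gaussian_smul hν hψ) a).smul _

theorem bargmannTransform_add (hν : 0 < ν) (hψ : MemLp ψ 2) (hφ : MemLp φ 2) :
    (bargmannTransform ν (ψ + φ) : 𝔸 → M) = bargmannTransform ν ψ + bargmannTransform ν φ := by
  funext a
  simp only [bargmannTransform, Pi.add_apply, smul_add]
  exact integral_add (integrable_bargmannKernel_smul hν hψ a)
    (integrable_bargmannKernel_smul hν hφ a)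

theorem differentiable_bargmannTransform (𝕜 : Type*) [RCLike 𝕜] [NormedAlgebra 𝕜 𝔸]
    [IsScalarTower ℝ 𝕜 𝔸] [NormedSpace 𝕜 M] [IsScalarTower 𝕜 𝔸 M]
    (hν : 0 < ν) (hψ : MemLp ψ 2) :
    Differentiable 𝕜 (bargmannTransform ν ψ : 𝔸 → M) := by
  have heq (a : 𝔸) : bargmannTransform ν ψ a = ((ν / Real.pi) ^ (3 / 4 : ℝ) : ℝ) •
      ∫ x, NormedSpace.exp ((-ν / 2) • a ^ 2 + (ν * √2 * x) • a) •
        Real.exp (-(ν / 2) * x ^ 2) • ψ x := by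
    simp only [bargmannTransform, bargmannKernel_smul_eq, integral_smul]
  rw [funext heq]
  exact (differentiable_integral_exp_smul 𝕜 (-ν / 2) (by fun_prop)
    ((by fun_prop : Continuous fun x : ℝ => Real.exp (-(ν / 2) * x ^ 2)).aestronglyMeasurable.smul
      hψ.1) (integrable_exp_mul_abs_gaussian_smul hν hψ)).const_smul _

end Transform

theorem eLpNorm_two_sq {α E : Type*} [MeasurableSpace α] {μ : Measure α} [NormedAddCommGroup E]
    (f : α → E) : eLpNorm f 2 μ ^ 2 = ∫⁻ x, ‖f x‖ₑ ^ 2 ∂μ := by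
  simpa using eLpNorm_nnreal_pow_eq_lintegral (f := f) (μ := μ) (p := 2) two_ne_zero

theorem lintegral_comp_mul_left {c : ℝ} (hc : c ≠ 0) (f : ℝ → ℝ≥0∞) :
    ∫⁻ x, f (c * x) = ENNReal.ofReal |c⁻¹| * ∫⁻ x, f x := by
  rw [← smul_eq_mul, ← lintegral_smul_measure, ← Real.map_volume_mul_left hc]
  exact ((Homeomorph.mulLeft₀ c hc).measurableEmbedding.lintegral_map f).symm

section GaussianVolume

/-- The measure `exp (-ν |z|²) dx dy` on the complex plane: the Fock space consists of the entire
functions that are square integrable for it. It is not normalized, its mass being `π / ν`. -/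
noncomputable def gaussianVolume (ν : ℝ) : Measure ℂ :=
  volume.withDensity fun z => ENNReal.ofReal (Real.exp (-ν * ‖z‖ ^ 2))

theorem measurable_gaussianDensity (ν : ℝ) :
    Measurable fun z : ℂ => ENNReal.ofReal (Real.exp (-ν * ‖z‖ ^ 2)) := by fun_prop

theorem lintegral_complex_eq_lintegral_lintegral {f : ℂ → ℝ≥0∞} (hf : Measurable f) :
    ∫⁻ z, f z = ∫⁻ u : ℝ, ∫⁻ v : ℝ, f (u + v * Complex.I) := by
  rw [← Complex.volume_preserving_equiv_real_prod.symm.lintegral_comp hf, Measure.volume_eq_prod,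
    lintegral_prod (fun p => f (Complex.measurableEquivRealProd.symm p))
      (hf.comp (MeasurableEquiv.measurable _)).aemeasurable]
  simp only [Complex.measurableEquivRealProd_symm_apply, Complex.mk_eq_add_mul_I]

theorem lintegral_gaussianVolume (ν : ℝ) {f : ℂ → ℝ≥0∞} (hf : Measurable f) :
    ∫⁻ z, f z ∂gaussianVolume ν
      = ∫⁻ u : ℝ, ∫⁻ v : ℝ, ENNReal.ofReal (Real.exp (-ν * (u ^ 2 + v ^ 2))) *
          f (u + v * Complex.I) := by
  have hnorm (u v : ℝ) : ‖(u : ℂ) + v * Complex.I‖ ^ 2 = u ^ 2 + v ^ 2 := by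
    rw [Complex.norm_add_mul_I, Real.sq_sqrt (by positivity)]
  rw [gaussianVolume, lintegral_withDensity_eq_lintegral_mul _ (measurable_gaussianDensity ν) hf,
    lintegral_complex_eq_lintegral_lintegral ((measurable_gaussianDensity ν).mul hf)]
  simp only [Pi.mul_apply, hnorm]

end GaussianVolume

section FourierForm

variable {E : Type*} [NormedAddCommGroup E] [NormedSpace ℂ E] {ν : ℝ}

theorem bargmannTransform_eq_fourier (ν : ℝ) (ψ : ℝ → E) (u v : ℝ) :
    bargmannTransform ν ψ (u + v * Complex.I : ℂ) =
      (((ν / Real.pi) ^ (3 / 4 : ℝ) * Real.exp (ν / 2 * (u ^ 2 + v ^ 2)) : ℝ) *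
        Complex.exp ((-(ν * u * v) : ℝ) * Complex.I)) •
        𝓕 (fun x : ℝ => Real.exp (-(ν / 2) * (x - √2 * u) ^ 2) • ψ x)
          (-(ν / (√2 * Real.pi)) * v) := by
  have hsqrt : (√2 : ℂ) ^ 2 = 2 := mod_cast Real.sq_sqrt zero_le_two
  have hsqrt0 : (√2 : ℂ) ≠ 0 := by simp
  have hpi : (Real.pi : ℂ) ≠ 0 := by simp [Real.pi_ne_zero]
  rw [bargmannTransform, Real.fourier_real_eq_integral_exp_smul, ← integral_smul]
  refine integral_congr_ae (.of_forall fun x => ?_)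
  simp only [bargmannKernel_smul_eq, ← Complex.coe_smul, ← Complex.exp_eq_exp_ℂ, smul_smul,
    Complex.ofReal_mul, Complex.ofReal_exp]
  simp only [mul_assoc, ← Complex.exp_add]
  congr 3
  push_cast
  simp only [smul_eq_mul]
  field_simp
  ring_nf
  simp only [Complex.I_sq, hsqrt]
  linear_combination (ν * √2 * u ^ 2 : ℂ) * hsqrt

theorem gaussian_mul_enorm_bargmannTransform_sq (hν : 0 ≤ ν) (ψ : ℝ → E) (u v : ℝ) :
    ENNReal.ofReal (Real.exp (-ν * (u ^ 2 + v ^ 2))) *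
        ‖bargmannTransform ν ψ (u + v * Complex.I : ℂ)‖ₑ ^ 2
      = ENNReal.ofReal ((ν / Real.pi) ^ (3 / 2 : ℝ)) *
        ‖𝓕 (fun x : ℝ => Real.exp (-(ν / 2) * (x - √2 * u) ^ 2) • ψ x)
          (-(ν / (√2 * Real.pi)) * v)‖ₑ ^ 2 := by
  have hpow : ((ν / Real.pi) ^ (3 / 4 : ℝ)) ^ 2 = (ν / Real.pi) ^ (3 / 2 : ℝ) := by
    rw [← Real.rpow_mul_natCast (by positivity)]
    norm_num
  rw [bargmannTransform_eq_fourier, enorm_smul, mul_pow, ← mul_assoc]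
  congr 1
  rw [← ofReal_norm, norm_mul, Complex.norm_exp_ofReal_mul_I, mul_one, Complex.norm_real,
    Real.norm_of_nonneg (by positivity), ← ENNReal.ofReal_pow (by positivity),
    ← ENNReal.ofReal_mul (by positivity), mul_pow, hpow, ← Real.exp_nat_mul, mul_left_comm,
    ← Real.exp_add]
  ring_nf
  rw [Real.exp_zero, mul_one]

end FourierForm

theorem lintegral_gaussian_sub_sqrt_two_mul {ν : ℝ} (hν : 0 < ν) (x : ℝ) :
    ∫⁻ u : ℝ, ENNReal.ofReal (Real.exp (-ν * (x - √2 * u) ^ 2))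
      = ENNReal.ofReal √(Real.pi / (2 * ν)) := by
  have hsqrt : √2 ^ 2 = (2 : ℝ) := Real.sq_sqrt zero_le_two
  have hshift (u : ℝ) : -ν * (x - √2 * u) ^ 2 = -(2 * ν) * (u - x / √2) ^ 2 := by
    have hfactor : x - √2 * u = -(√2 * (u - x / √2)) := by field_simp; ring
    rw [hfactor, neg_sq, mul_pow, hsqrt]
    ring
  simp only [hshift]
  rw [lintegral_sub_right_eq_self (fun u : ℝ => ENNReal.ofReal (Real.exp (-(2 * ν) * u ^ 2))),
    ← ofReal_integral_eq_lintegral_ofReal (integrable_exp_neg_mul_sq (by positivity))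
      (.of_forall fun u => (Real.exp_pos _).le), integral_gaussian]

theorem bargmann_constant_eq_one {ν : ℝ} (hν : 0 < ν) :
    (ν / Real.pi) ^ (3 / 2 : ℝ) * (√2 * Real.pi / ν) * √(Real.pi / (2 * ν)) = 1 := by
  have hnu : 0 < ν / Real.pi := by positivity
  have hpow : (ν / Real.pi) ^ (3 / 2 : ℝ) = ν / Real.pi * √(ν / Real.pi) := by
    rw [Real.sqrt_eq_rpow, ← Real.rpow_one_add' hnu.le (by norm_num)]
    norm_num
  have hroot : √(ν / Real.pi) * (√2 * √(Real.pi / (2 * ν))) = 1 := by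
    rw [← Real.sqrt_mul zero_le_two, ← Real.sqrt_mul hnu.le, Real.sqrt_eq_one]
    field_simp
  calc _ = (ν / Real.pi * (Real.pi / ν)) *
        (√(ν / Real.pi) * (√2 * √(Real.pi / (2 * ν)))) := by rw [hpow]; ring
    _ = 1 := by rw [hroot]; field_simp

section Isometry

variable {E : Type*} [NormedAddCommGroup E] [InnerProductSpace ℂ E] [CompleteSpace E] {ν : ℝ}
  {ψ : ℝ → E}

theorem lintegral_enorm_fourier_comp_mul_left_sq {f : ℝ → E}
    (h1 : Integrable f) (h2 : MemLp f 2) {c : ℝ} (hc : c ≠ 0) :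
    ∫⁻ ξ : ℝ, ‖𝓕 f (c * ξ)‖ₑ ^ 2 = ENNReal.ofReal |c⁻¹| * ∫⁻ x, ‖f x‖ₑ ^ 2 := by
  rw [lintegral_comp_mul_left hc fun ξ => ‖𝓕 f ξ‖ₑ ^ 2, ← eLpNorm_two_sq,
    eLpNorm_fourier_two h1 h2, eLpNorm_two_sq]

theorem lintegral_vertical_enorm_bargmannTransform_sq (hν : 0 < ν)
    (hψ : MemLp ψ 2) (u : ℝ) :
    ∫⁻ v : ℝ, ENNReal.ofReal (Real.exp (-ν * (u ^ 2 + v ^ 2))) *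
        ‖bargmannTransform ν ψ (u + v * Complex.I : ℂ)‖ₑ ^ 2
      = ENNReal.ofReal ((ν / Real.pi) ^ (3 / 2 : ℝ) * (√2 * Real.pi / ν)) *
        ∫⁻ x : ℝ, ENNReal.ofReal (Real.exp (-ν * (x - √2 * u) ^ 2)) * ‖ψ x‖ₑ ^ 2 := by
  have hκ : 0 < ν / (√2 * Real.pi) := by positivity
  have hweight (x : ℝ) : ‖Real.exp (-(ν / 2) * (x - √2 * u) ^ 2) • ψ x‖ₑ ^ 2
      = ENNReal.ofReal (Real.exp (-ν * (x - √2 * u) ^ 2)) * ‖ψ x‖ₑ ^ 2 := by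
    rw [enorm_smul, mul_pow, Real.enorm_of_nonneg (Real.exp_pos _).le,
      ← ENNReal.ofReal_pow (Real.exp_pos _).le, ← Real.exp_nat_mul]
    ring_nf
  simp only [gaussian_mul_enorm_bargmannTransform_sq hν.le]
  rw [lintegral_const_mul' _ _ ENNReal.ofReal_ne_top, lintegral_enorm_fourier_comp_mul_left_sq
    (integrable_gaussian_sub_smul (half_pos hν) hψ _)
    (memLp_gaussian_sub_smul (half_pos hν).le hψ _)
    (neg_ne_zero.mpr hκ.ne'), ← mul_assoc, ← ENNReal.ofReal_mul (by positivity), inv_neg, abs_neg,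
    abs_of_pos (inv_pos.mpr hκ), inv_div]
  simp only [hweight]

theorem eLpNorm_bargmannTransform (hν : 0 < ν) (hψ : MemLp ψ 2) :
    eLpNorm (bargmannTransform ν ψ : ℂ → E) 2 (gaussianVolume ν) = eLpNorm ψ 2 := by
  have hcont := (differentiable_bargmannTransform (𝔸 := ℂ) ℂ hν hψ).continuous
  have hdensity : Measurable fun p : ℝ × ℝ =>
      ENNReal.ofReal (Real.exp (-ν * (p.2 - √2 * p.1) ^ 2)) := by fun_prop
  refine (ENNReal.pow_right_strictMono two_ne_zero).injective ?_
  simp only [eLpNorm_two_sq]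
  rw [lintegral_gaussianVolume ν (hcont.enorm.measurable.pow_const 2)]
  simp only [lintegral_vertical_enorm_bargmannTransform_sq hν hψ]
  rw [lintegral_const_mul' _ _ ENNReal.ofReal_ne_top,
    lintegral_lintegral_swap (hdensity.aemeasurable.mul (hψ.1.enorm.pow_const 2).comp_snd)]
  have hinner (x : ℝ) : ∫⁻ u : ℝ, ENNReal.ofReal (Real.exp (-ν * (x - √2 * u) ^ 2)) *
      ‖ψ x‖ₑ ^ 2 = ENNReal.ofReal √(Real.pi / (2 * ν)) * ‖ψ x‖ₑ ^ 2 := by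
    rw [lintegral_mul_const' _ _ (by finiteness), lintegral_gaussian_sub_sqrt_two_mul hν]
  simp only [hinner]
  rw [lintegral_const_mul' _ _ ENNReal.ofReal_ne_top, ← mul_assoc,
    ← ENNReal.ofReal_mul (by positivity), bargmann_constant_eq_one hν, ENNReal.ofReal_one, one_mul]

theorem memLp_bargmannTransform (hν : 0 < ν) (hψ : MemLp ψ 2) :
    MemLp (bargmannTransform ν ψ : ℂ → E) 2 (gaussianVolume ν) :=
  ⟨(differentiable_bargmannTransform (𝔸 := ℂ) ℂ hν hψ).continuous.aestronglyMeasurable,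
    (eLpNorm_bargmannTransform hν hψ).trans_lt hψ.2⟩

end Isometry

section MeanValue

variable {E : Type*} [NormedAddCommGroup E] [NormedSpace ℂ E] [CompleteSpace E]

theorem circleAverage_comp_mul_right {H : ℂ → E} (hH : Differentiable ℂ H) (z : ℂ) :
    Real.circleAverage (fun w => H (w * z)) 0 1 = H 0 := by
  have hdiff : Differentiable ℂ fun w => H (w * z) := by fun_prop
  rw [hdiff.diffContOnCl.circleAverage, zero_mul]

theorem integral_eq_measureReal_univ_smul_of_differentiable {μ : Measure ℂ} [IsFiniteMeasure μ]
    (hμ : ∀ c : Circle, MeasurePreserving (rotation c) μ μ) {H : ℂ → E} (hH : Differentiable ℂ H)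
    (hint : Integrable H μ) : ∫ z, H z ∂μ = μ.real Set.univ • H 0 := by
  have : IsFiniteMeasure ((volume : Measure ℝ).restrict (Set.uIoc 0 (2 * Real.pi))) :=
    Real.isFiniteMeasure_restrict_Ioc _ _
  have hskew : MeasurePreserving (fun p : ℝ × ℂ => (p.1, rotation (Circle.exp p.1) p.2))
      ((volume.restrict (Set.uIoc 0 (2 * Real.pi))).prod μ)
      ((volume.restrict (Set.uIoc 0 (2 * Real.pi))).prod μ) := by
    refine (MeasurePreserving.id _).skew_product
      (g := fun (θ : ℝ) (z : ℂ) => rotation (Circle.exp θ) z) ?_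
      (.of_forall fun θ => (hμ (Circle.exp θ)).map_eq)
    simp only [rotation_apply]
    fun_prop
  have hprod : Integrable (Function.uncurry fun (θ : ℝ) (z : ℂ) => H (rotation (Circle.exp θ) z))
      ((volume.restrict (Set.uIoc 0 (2 * Real.pi))).prod μ) :=
    hskew.integrable_comp_of_integrable (hint.comp_snd _)
  have hrotate (θ : ℝ) : ∫ z, H (rotation (Circle.exp θ) z) ∂μ = ∫ z, H z ∂μ :=
    (hμ _).integral_comp (rotation _).toHomeomorph.measurableEmbedding H
  have haverage (z : ℂ) :
      (2 * Real.pi)⁻¹ • ∫ θ in (0)..2 * Real.pi, H (rotation (Circle.exp θ) z) = H 0 := by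
    simpa [Real.circleAverage, circleMap, rotation_apply] using circleAverage_comp_mul_right hH z
  calc ∫ z, H z ∂μ
      = (2 * Real.pi)⁻¹ • ∫ θ in (0)..2 * Real.pi, ∫ z, H (rotation (Circle.exp θ) z) ∂μ := by
        simp only [hrotate, intervalIntegral.integral_const, sub_zero]
        rw [inv_smul_smul₀ (by positivity)]
    _ = ∫ z, (2 * Real.pi)⁻¹ • (∫ θ in (0)..2 * Real.pi, H (rotation (Circle.exp θ) z)) ∂μ := by
        rw [integral_smul, intervalIntegral_integral_swap hprod]
    _ = μ.real Set.univ • H 0 := by simp only [haverage, integral_const]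

end MeanValue

section GaussianVolumeIntegral

variable {E : Type*} [NormedAddCommGroup E] [NormedSpace ℝ E]

theorem integrable_gaussianVolume_iff {ν : ℝ} {f : ℂ → E} :
    Integrable f (gaussianVolume ν) ↔ Integrable fun z => Real.exp (-ν * ‖z‖ ^ 2) • f z := by
  rw [gaussianVolume, integrable_withDensity_iff_integrable_smul' (measurable_gaussianDensity ν)
    (.of_forall fun _ => ENNReal.ofReal_lt_top)]
  simp only [ENNReal.toReal_ofReal (Real.exp_pos _).le]

theorem integral_gaussianVolume (ν : ℝ) (f : ℂ → E) :
    ∫ z, f z ∂gaussianVolume ν = ∫ z, Real.exp (-ν * ‖z‖ ^ 2) • f z := by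
  rw [gaussianVolume, integral_withDensity_eq_integral_toReal_smul (measurable_gaussianDensity ν)
    (.of_forall fun _ => ENNReal.ofReal_lt_top)]
  simp only [ENNReal.toReal_ofReal (Real.exp_pos _).le]

theorem gaussianVolume_univ {ν : ℝ} (hν : 0 < ν) :
    gaussianVolume ν Set.univ = ENNReal.ofReal (Real.pi / ν) := by
  have hmass : ∫ z : ℂ, Real.exp (-ν * ‖z‖ ^ 2) = Real.pi / ν := by
    rw [GaussianFourier.integral_rexp_neg_mul_sq_norm hν, Complex.finrank_real_complex,
      Nat.cast_ofNat, div_self two_ne_zero, Real.rpow_one]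
  rw [gaussianVolume, withDensity_apply _ MeasurableSet.univ, setLIntegral_univ, ← hmass,
    ofReal_integral_eq_lintegral_ofReal
      (.of_integral_ne_zero (hmass.trans_ne (by positivity)))
      (.of_forall fun z => (Real.exp_pos _).le)]

theorem measurePreserving_rotation_gaussianVolume (ν : ℝ) (c : Circle) :
    MeasurePreserving (rotation c) (gaussianVolume ν) (gaussianVolume ν) := by
  refine ⟨(rotation c).continuous.measurable, Measure.ext fun s hs => ?_⟩
  have hpreimage := (rotation c).continuous.measurable hs
  rw [Measure.map_apply (rotation c).continuous.measurable hs, gaussianVolume,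
    withDensity_apply _ hs, withDensity_apply _ hpreimage,
    ← (rotation c).measurePreserving.setLIntegral_comp_preimage hs (measurable_gaussianDensity ν)]
  simp only [LinearIsometryEquiv.norm_map]

end GaussianVolumeIntegral

section ReproducingFormula

variable {E : Type*} [NormedAddCommGroup E] [NormedSpace ℂ E] {ν : ℝ} {D : ℂ → E}

theorem gaussian_smul_exp_conj_mul_smul_add (ν : ℝ) (D : ℂ → E) (w z : ℂ) :
    Real.exp (-ν * ‖z + w‖ ^ 2) • Complex.exp (ν * (starRingEnd ℂ (z + w) * w)) • D (z + w)
      = Real.exp (-ν * ‖z‖ ^ 2) • Complex.exp (-ν * (starRingEnd ℂ w * z)) • D (z + w) := by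
  simp only [← Complex.coe_smul, smul_smul, Complex.ofReal_exp, ← Complex.exp_add]
  congr 2
  push_cast
  simp only [← Complex.mul_conj', map_add]
  ring

/-- Translating by `w` turns the conjugate exponential into a holomorphic factor equal to `1` at
`0`, so that the formula becomes the mean value property. -/
theorem integral_exp_conj_mul_smul_gaussianVolume [CompleteSpace E] (hν : 0 < ν)
    (hD : Differentiable ℂ D) (w : ℂ)
    (hint : Integrable (fun z => Complex.exp (ν * (starRingEnd ℂ z * w)) • D z)
      (gaussianVolume ν)) :
    ∫ z, Complex.exp (ν * (starRingEnd ℂ z * w)) • D z ∂gaussianVolume ν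
      = (Real.pi / ν) • D w := by
  have : IsFiniteMeasure (gaussianVolume ν) :=
    ⟨(gaussianVolume_univ hν).trans_lt ENNReal.ofReal_lt_top⟩
  have hmass : (gaussianVolume ν).real Set.univ = Real.pi / ν := by
    rw [measureReal_def, gaussianVolume_univ hν, ENNReal.toReal_ofReal (by positivity)]
  have hdiff : Differentiable ℂ fun z =>
      Complex.exp (-ν * (starRingEnd ℂ w * z)) • D (z + w) := by fun_prop
  have hint' : Integrable (fun z => Complex.exp (-ν * (starRingEnd ℂ w * z)) • D (z + w))
      (gaussianVolume ν) := by
    rw [integrable_gaussianVolume_iff] at hint ⊢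
    simpa only [gaussian_smul_exp_conj_mul_smul_add] using hint.comp_add_right w
  calc ∫ z, Complex.exp (ν * (starRingEnd ℂ z * w)) • D z ∂gaussianVolume ν
      = ∫ z, Complex.exp (-ν * (starRingEnd ℂ w * z)) • D (z + w) ∂gaussianVolume ν := by
        rw [integral_gaussianVolume, integral_gaussianVolume, ← integral_add_right_eq_self _ w]
        simp only [gaussian_smul_exp_conj_mul_smul_add]
    _ = (Real.pi / ν) • D w := by
        rw [integral_eq_measureReal_univ_smul_of_differentiable
          (measurePreserving_rotation_gaussianVolume ν) hdiff hint', hmass]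
        simp

end ReproducingFormula

theorem memLp_bargmannKernel {𝔸 : Type*} [NormedRing 𝔸] [NormedAlgebra ℝ 𝔸] [NormOneClass 𝔸]
    [CompleteSpace 𝔸] {ν : ℝ} (hν : 0 < ν) (a : 𝔸) : MemLp (bargmannKernel ν a) 2 := by
  refine ((memLp_exp_mul_abs_mul_gaussian (half_pos hν) (|ν * √2| * ‖a‖)).const_mul
    ((ν / Real.pi) ^ (3 / 4 : ℝ) * Real.exp (|-ν / 2| * ‖a‖ ^ 2))).mono
    (continuous_bargmannKernel ν a).aestronglyMeasurable (.of_forall fun x => ?_)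
  rw [bargmannKernel_eq, norm_smul, Real.norm_of_nonneg (by positivity),
    Real.norm_of_nonneg (by positivity)]
  calc _ ≤ (ν / Real.pi) ^ (3 / 4 : ℝ) * Real.exp (-(ν / 2) * x ^ 2) *
        Real.exp (|-ν / 2| * ‖a‖ ^ 2 + |ν * √2 * x| * ‖a‖) := by
        gcongr
        exact (norm_exp_le _).trans (Real.exp_le_exp.mpr (norm_smul_sq_add_smul_le _ _ le_rfl))
    _ = _ := by rw [Real.exp_add, abs_mul (ν * √2), mul_right_comm |ν * √2|]; ring

section ConjugateKernel

variable {ν : ℝ}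

theorem bargmannKernel_complex (ν : ℝ) (z : ℂ) (x : ℝ) :
    bargmannKernel ν z x = ((ν / Real.pi) ^ (3 / 4 : ℝ) : ℝ) *
      Complex.exp (-ν / 2 * (z ^ 2 + x ^ 2) + ν * √2 * (z * x)) := by
  simp [bargmannKernel, Complex.exp_eq_exp_ℂ, mul_add]

theorem bargmannKernel_mul_conj_bargmannKernel (hν : 0 < ν) (z w : ℂ) (x : ℝ) :
    bargmannKernel ν z x * starRingEnd ℂ (bargmannKernel ν w x)
      = ((ν / Real.pi) ^ (3 / 2 : ℝ) : ℝ) * Complex.exp ((-ν : ℝ) * x ^ 2 +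
        (ν * √2 * (z + starRingEnd ℂ w)) * x + (-ν / 2 * (z ^ 2 + starRingEnd ℂ w ^ 2))) := by
  have hconst : (ν / Real.pi) ^ (3 / 2 : ℝ)
      = (ν / Real.pi) ^ (3 / 4 : ℝ) * (ν / Real.pi) ^ (3 / 4 : ℝ) := by
    rw [← Real.rpow_add (by positivity)]
    norm_num
  simp only [bargmannKernel_complex, map_mul, Complex.conj_ofReal, ← Complex.exp_conj, map_add,
    map_pow, map_div₀, map_neg, map_ofNat]
  rw [mul_mul_mul_comm, ← Complex.exp_add, hconst, ← Complex.ofReal_mul]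
  congr 2
  push_cast
  ring

theorem integral_bargmannKernel_mul_conj_bargmannKernel (hν : 0 < ν) (z w : ℂ) :
    ∫ x : ℝ, bargmannKernel ν z x * starRingEnd ℂ (bargmannKernel ν w x)
      = (ν / Real.pi : ℝ) * Complex.exp (ν * (z * starRingEnd ℂ w)) := by
  have hratio : 0 < ν / Real.pi := by positivity
  have hroot : ((Real.pi : ℂ) / -((-ν : ℝ) : ℂ)) ^ (1 / 2 : ℂ)
      = ((ν / Real.pi) ^ (-(1 / 2) : ℝ) : ℝ) := by
    rw [Real.rpow_neg hratio.le, ← Real.inv_rpow hratio.le, inv_div,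
      Complex.ofReal_cpow (by positivity)]
    simp
  have hconst : (ν / Real.pi) ^ (3 / 2 : ℝ) * (ν / Real.pi) ^ (-(1 / 2) : ℝ) = ν / Real.pi := by
    rw [← Real.rpow_add hratio]
    norm_num
  have hsqrt : (√2 : ℂ) ^ 2 = 2 := mod_cast Real.sq_sqrt zero_le_two
  simp only [bargmannKernel_mul_conj_bargmannKernel hν]
  rw [integral_const_mul, integral_cexp_quadratic (by simpa using hν), hroot, ← mul_assoc,
    ← Complex.ofReal_mul, hconst]
  congr 2
  have hν0 : (ν : ℂ) ≠ 0 := mod_cast hν.ne'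
  push_cast
  field_simp
  ring_nf
  simp only [hsqrt]
  ring

variable {E : Type*} [NormedAddCommGroup E] [NormedSpace ℂ E]

theorem memLp_conj_bargmannKernel_smul (hν : 0 < ν) (w : ℂ) (c : E) :
    MemLp (fun x => starRingEnd ℂ (bargmannKernel ν w x) • c) 2 :=
  ((memLp_bargmannKernel hν w).norm.const_mul ‖c‖).congr_norm
    ((Complex.continuous_conj.comp (continuous_bargmannKernel ν w)).smul
      continuous_const).aestronglyMeasurable
    (.of_forall fun x => by simp [norm_smul, mul_comm])

theorem bargmannTransform_conj_bargmannKernel [CompleteSpace E] (hν : 0 < ν) (w z : ℂ) (c : E) :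
    bargmannTransform ν (fun x => starRingEnd ℂ (bargmannKernel ν w x) • c) z
      = (ν / Real.pi) • Complex.exp (ν * (z * starRingEnd ℂ w)) • c := by
  simp only [bargmannTransform, smul_smul]
  rw [integral_smul_const, integral_bargmannKernel_mul_conj_bargmannKernel hν, mul_smul,
    Complex.coe_smul]

end ConjugateKernel

section Surjectivity

variable {E : Type*} [NormedAddCommGroup E] [InnerProductSpace ℂ E] [CompleteSpace E] {ν : ℝ}

/-- The complex Segal-Bargmann transform as a linear isometry between `L²` spaces. -/
noncomputable def bargmannIsometry (hν : 0 < ν) :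
    Lp E 2 (volume : Measure ℝ) →ₗᵢ[ℂ] Lp E 2 (gaussianVolume ν) where
  toFun ψ := (memLp_bargmannTransform hν (Lp.memLp ψ)).toLp _
  map_add' φ ψ := by
    rw [← MemLp.toLp_add]
    congr 1
    rw [← bargmannTransform_add hν (Lp.memLp φ) (Lp.memLp ψ)]
    exact funext (bargmannTransform_congr_ae (Lp.coeFn_add φ ψ) ν)
  map_smul' c ψ := by
    rw [RingHom.id_apply, ← MemLp.toLp_const_smul]
    congr 1
    funext z
    rw [bargmannTransform_congr_ae (Lp.coeFn_smul c ψ)]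
    simp only [bargmannTransform, Pi.smul_apply, smul_comm _ c, integral_smul]
  norm_map' ψ := by
    rw [LinearMap.coe_mk, AddHom.coe_mk, Lp.norm_toLp, eLpNorm_bargmannTransform hν (Lp.memLp ψ),
      Lp.norm_def]

theorem coeFn_bargmannIsometry_toLp (hν : 0 < ν) {ψ : ℝ → E} (hψ : MemLp ψ 2) :
    bargmannIsometry hν (hψ.toLp ψ) =ᵐ[gaussianVolume ν] bargmannTransform ν ψ := by
  rw [← funext (bargmannTransform_congr_ae hψ.coeFn_toLp ν)]
  exact (memLp_bargmannTransform hν (Lp.memLp (hψ.toLp ψ))).coeFn_toLp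

theorem inner_bargmannIsometry_conj_bargmannKernel (hν : 0 < ν) {D : ℂ → E}
    (hD : Differentiable ℂ D) (hD2 : MemLp D 2 (gaussianVolume ν)) (w : ℂ) (c : E) :
    inner ℂ (bargmannIsometry hν ((memLp_conj_bargmannKernel_smul hν w c).toLp _)) (hD2.toLp D)
      = inner ℂ c (D w) := by
  set k := bargmannIsometry hν ((memLp_conj_bargmannKernel_smul hν w c).toLp _)
  have hinner : (fun z => inner ℂ (k z) (hD2.toLp D z)) =ᵐ[gaussianVolume ν] fun z =>
      (ν / Real.pi : ℂ) • Complex.exp (ν * (starRingEnd ℂ z * w)) • inner ℂ c (D z) := by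
    filter_upwards [coeFn_bargmannIsometry_toLp hν (memLp_conj_bargmannKernel_smul hν w c),
      hD2.coeFn_toLp] with z hk hDz
    rw [hk, hDz, bargmannTransform_conj_bargmannKernel hν, ← Complex.coe_smul, inner_smul_left,
      inner_smul_left, ← Complex.exp_conj]
    simp
  have hconst : (ν / Real.pi : ℂ) ≠ 0 := by simp [hν.ne', Real.pi_ne_zero]
  rw [L2.inner_def, integral_congr_ae hinner, integral_smul,
    integral_exp_conj_mul_smul_gaussianVolume (D := fun z => inner ℂ c (D z)) hν
      ((innerSL ℂ c).differentiable.comp hD)]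
  · rw [← Complex.coe_smul, smul_smul]
    push_cast
    rw [div_mul_div_cancel₀ (by simp [Real.pi_ne_zero]), div_self (by simp [hν.ne']), one_smul]
  · exact (integrable_smul_iff hconst _).mp ((L2.integrable_inner _ _).congr hinner)

theorem exists_bargmannTransform_eq (hν : 0 < ν) {F : ℂ → E} (hF : Differentiable ℂ F)
    (hF2 : MemLp F 2 (gaussianVolume ν)) :
    ∃ ψ : ℝ → E, MemLp ψ 2 ∧ bargmannTransform ν ψ = F := by
  let K := (bargmannIsometry (E := E) hν).toLinearMap.range
  have : CompleteSpace K :=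
    (bargmannIsometry hν).isometry.isUniformInducing.isComplete_range.completeSpace_coe
  obtain ⟨_, ⟨ψ, rfl⟩, r, hr, hsum⟩ := K.exists_add_mem_mem_orthogonal (hF2.toLp _)
  have hψ := Lp.memLp ψ
  have hD2 := hF2.sub (memLp_bargmannTransform hν hψ)
  have hrD : r = hD2.toLp _ := by
    rw [MemLp.toLp_sub hF2 (memLp_bargmannTransform hν hψ), hsum]
    exact (add_sub_cancel_left _ _).symm
  have hD := hF.sub (differentiable_bargmannTransform (𝔸 := ℂ) ℂ hν hψ)
  refine ⟨ψ, hψ, funext fun w => (sub_eq_zero.mp (ext_inner_left ℂ fun c => ?_)).symm⟩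
  rw [inner_zero_right, ← hr _ ⟨_, rfl⟩, hrD]
  exact (inner_bargmannIsometry_conj_bargmannKernel hν hD hD2 w c).symm

end Surjectivity

section Slices

variable {I : ℍ}

theorem norm_eq_one_of_sq_eq_neg_one (hI : I ^ 2 = -1) : ‖I‖ = 1 := by
  refine (pow_eq_one_iff_of_nonneg (norm_nonneg _) two_ne_zero).mp ?_
  rw [← norm_pow, hI, norm_neg, norm_one]

theorem re_eq_zero_of_sq_eq_neg_one (hI : I ^ 2 = -1) : I.re = 0 := by
  rw [← Quaternion.sq_eq_neg_normSq, hI, Quaternion.normSq_eq_norm_mul_self,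
    norm_eq_one_of_sq_eq_neg_one hI, one_mul, Quaternion.coe_one]

/-- The embedding `x + i y ↦ x + y I` of `ℂ` onto the slice `ℂ_I`. -/
noncomputable def sliceEmbedding (hI : I ^ 2 = -1) : ℂ →ₐ[ℝ] ℍ :=
  Complex.lift ⟨I, by rw [← pow_two, hI]⟩

theorem sliceEmbedding_apply (hI : I ^ 2 = -1) (z : ℂ) :
    sliceEmbedding hI z = (z.re : ℍ) + (z.im : ℍ) * I := by
  rw [sliceEmbedding, Complex.lift_apply, Complex.liftAux_apply, ← Quaternion.coe_mul_eq_smul]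
  rfl

theorem sliceEmbedding_I (hI : I ^ 2 = -1) : sliceEmbedding hI Complex.I = I := by
  simp [sliceEmbedding_apply]

theorem sliceEmbedding_ofReal (hI : I ^ 2 = -1) (x : ℝ) : sliceEmbedding hI (x : ℂ) = x :=
  (sliceEmbedding hI).commutes x

theorem norm_sliceEmbedding (hI : I ^ 2 = -1) (z : ℂ) : ‖sliceEmbedding hI z‖ = ‖z‖ := by
  have hinner : inner ℝ (z.re : ℍ) ((z.im : ℍ) * I) = 0 := by
    simp [Quaternion.inner_def, re_eq_zero_of_sq_eq_neg_one hI]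
  rw [← sq_eq_sq₀ (norm_nonneg _) (norm_nonneg _), sliceEmbedding_apply, norm_add_sq_real, hinner,
    norm_mul, norm_eq_one_of_sq_eq_neg_one hI, Quaternion.norm_coe, Quaternion.norm_coe,
    Complex.sq_norm, Complex.normSq_apply]
  simp [pow_two]

theorem continuous_sliceEmbedding (hI : I ^ 2 = -1) : Continuous (sliceEmbedding hI) :=
  (sliceEmbedding hI).toLinearMap.continuous_of_finiteDimensional

theorem exists_sliceEmbedding_eq {q : ℍ} (hq : q.im ≠ 0) :
    ∃ (I : ℍ) (hI : I ^ 2 = -1) (z : ℂ), sliceEmbedding hI z = q := by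
  have hnorm : ‖q.im‖ ≠ 0 := norm_ne_zero_iff.mpr hq
  refine ⟨‖q.im‖⁻¹ • q.im, ?_, ⟨q.re, ‖q.im‖⟩, ?_⟩
  · rw [smul_pow, Quaternion.im_sq, Quaternion.normSq_eq_norm_mul_self, smul_neg,
      Quaternion.smul_coe, ← pow_two, ← mul_pow, inv_mul_cancel₀ hnorm, one_pow,
      Quaternion.coe_one]
  · rw [sliceEmbedding_apply, Quaternion.coe_mul_eq_smul, smul_inv_smul₀ hnorm,
      Quaternion.re_add_im]

/-- The quaternions as a complex Hilbert space, `ℂ` acting by left multiplication through the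
slice `ℂ_I`. Slice regularity on `ℂ_I` is holomorphy with values in this space. -/
def SliceModule (_ : I ^ 2 = -1) : Type := ℍ

variable (hI : I ^ 2 = -1)

noncomputable instance : NormedAddCommGroup (SliceModule hI) :=
  inferInstanceAs (NormedAddCommGroup ℍ)

instance : CompleteSpace (SliceModule hI) :=
  inferInstanceAs (CompleteSpace ℍ)

noncomputable instance : Module ℂ (SliceModule hI) :=
  Module.compHom ℍ (sliceEmbedding hI).toRingHom

noncomputable instance : NormedSpace ℂ (SliceModule hI) where
  norm_smul_le z (q : ℍ) :=
    (norm_mul_le (sliceEmbedding hI z) q).trans_eq (congrArg (· * _) (norm_sliceEmbedding hI z))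

noncomputable instance : InnerProductSpace ℂ (SliceModule hI) :=
  InnerProductSpace.ofNorm ℂ fun (a b : ℍ) => by
    simpa only [pow_two] using! parallelogram_law_with_norm ℝ a b

/-- The identity map from the quaternions to `SliceModule hI`. -/
noncomputable def toSlice : ℍ ≃ₗᵢ[ℝ] SliceModule hI where
  toFun q := q
  invFun q := q
  left_inv _ := rfl
  right_inv _ := rfl
  map_add' _ _ := rfl
  map_smul' r q := by
    change r • q = sliceEmbedding hI (r : ℂ) * q
    rw [sliceEmbedding_ofReal, Quaternion.coe_mul_eq_smul]
  norm_map' _ := rfl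

theorem toSlice_mul (z : ℂ) (q : ℍ) : toSlice hI (sliceEmbedding hI z * q) = z • toSlice hI q :=
  rfl

theorem toSlice_I_mul (q : ℍ) : toSlice hI (I * q) = Complex.I • toSlice hI q := by
  rw [← toSlice_mul, sliceEmbedding_I]

end Slices

section SliceRegularity

variable {I : ℍ} {f g : ℍ → ℍ}

theorem sliceFun_eq (hI : I ^ 2 = -1) (f : ℍ → ℍ) (p : ℝ × ℝ) :
    sliceFun f I p = f (sliceEmbedding hI (Complex.equivRealProdCLM.symm p)) := by
  rw [sliceFun, sliceEmbedding_apply]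
  rfl

/-- The restriction of `f` to the slice `ℂ_I`, as a function of a complex variable with values in
the complex Hilbert space `SliceModule hI`. -/
noncomputable def sliceRestrict (hI : I ^ 2 = -1) (f : ℍ → ℍ) (z : ℂ) : SliceModule hI :=
  toSlice hI (f (sliceEmbedding hI z))

theorem differentiable_real_sliceRestrict (hI : I ^ 2 = -1) (hf : Differentiable ℝ f) :
    Differentiable ℝ (sliceRestrict hI f) :=
  (toSlice hI).toContinuousLinearEquiv.differentiable.comp
    (hf.comp (sliceEmbedding hI).toLinearMap.toContinuousLinearMap.differentiable)

theorem toSlice_deriv_sliceFun_comp (hI : I ^ 2 = -1) (hf : Differentiable ℝ f) {γ : ℝ → ℝ × ℝ}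
    {v : ℝ × ℝ} {t : ℝ} (hγ : HasDerivAt γ v t) :
    toSlice hI (deriv (fun s => sliceFun f I (γ s)) t)
      = fderiv ℝ (sliceRestrict hI f) (Complex.equivRealProdCLM.symm (γ t))
          (Complex.equivRealProdCLM.symm v) := by
  have hcurve := Complex.equivRealProdCLM.symm.hasFDerivAt.comp_hasDerivAt t hγ
  have hrestrict :=
    (differentiable_real_sliceRestrict hI hf _).hasFDerivAt.comp_hasDerivAt t hcurve
  have hderiv := (toSlice hI).symm.toContinuousLinearEquiv.hasFDerivAt.comp_hasDerivAt t hrestrict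
  simp only [sliceFun_eq hI]
  exact (congrArg (toSlice hI) hderiv.deriv :)

theorem toSlice_dbar (hI : I ^ 2 = -1) (hf : Differentiable ℝ f) (x y : ℝ) :
    toSlice hI (dbar I f x y) = (1 / 2 : ℝ) • (fderiv ℝ (sliceRestrict hI f) ⟨x, y⟩ 1
      + Complex.I • fderiv ℝ (sliceRestrict hI f) ⟨x, y⟩ Complex.I) := by
  have hx := toSlice_deriv_sliceFun_comp hI hf ((hasDerivAt_id x).prodMk (hasDerivAt_const x y))
  have hy := toSlice_deriv_sliceFun_comp hI hf ((hasDerivAt_const y x).prodMk (hasDerivAt_id y))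
  rw [dbar, map_smul, map_add, toSlice_I_mul]
  exact congrArg ((1 / 2 : ℝ) • ·) (congrArg₂ (· + Complex.I • ·) hx hy)

theorem dbar_eq_zero_iff (hI : I ^ 2 = -1) (hf : Differentiable ℝ f) (x y : ℝ) :
    dbar I f x y = 0 ↔ DifferentiableAt ℂ (sliceRestrict hI f) ⟨x, y⟩ := by
  rw [differentiableAt_complex_iff_differentiableAt_real,
    and_iff_right (differentiable_real_sliceRestrict hI hf _), ← (toSlice hI).map_eq_zero_iff,
    toSlice_dbar hI hf, smul_eq_zero_iff_right (by norm_num),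
    ← (smul_right_injective _ Complex.I_ne_zero).eq_iff (b := _ • _), smul_smul, Complex.I_mul_I,
    neg_one_smul, eq_neg_iff_add_eq_zero, add_comm]

theorem sliceRegular_iff : SliceRegular f ↔ Differentiable ℝ f ∧
    ∀ (I : ℍ) (hI : I ^ 2 = -1), Differentiable ℂ (sliceRestrict hI f) := by
  refine ⟨fun hf => ⟨hf.differentiable, fun I hI z =>
    (dbar_eq_zero_iff hI hf.differentiable z.re z.im).mp (hf.dbar_eq_zero I hI _ _)⟩,
    fun ⟨hf, hslice⟩ => ⟨hf, fun I hI => ?_, fun I hI x y =>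
      (dbar_eq_zero_iff hI hf x y).mpr (hslice I hI _)⟩⟩
  rw [funext (sliceFun_eq hI f)]
  exact (toSlice hI).symm.toContinuousLinearEquiv.contDiff.comp
    (((hslice I hI).contDiff.restrict_scalars ℝ).comp Complex.equivRealProdCLM.symm.contDiff)

theorem SliceRegular.differentiable_sliceRestrict (hf : SliceRegular f) (hI : I ^ 2 = -1) :
    Differentiable ℂ (sliceRestrict hI f) :=
  (sliceRegular_iff.mp hf).2 I hI

theorem SliceRegular.eq_of_forall_real (hf : SliceRegular f) (hg : SliceRegular g)
    (h : ∀ x : ℝ, f x = g x) : f = g := by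
  funext q
  by_cases hq : q.im = 0
  · rw [← Quaternion.re_add_im q, hq, add_zero, h]
  obtain ⟨K, hK, z, rfl⟩ := exists_sliceEmbedding_eq hq
  have hreal (x : ℝ) : sliceRestrict hK f x = sliceRestrict hK g x := by
    rw [sliceRestrict, sliceRestrict, sliceEmbedding_ofReal, h]
  have hofReal : Filter.Tendsto ((↑) : ℝ → ℂ) (nhdsWithin 0 {0}ᶜ) (nhdsWithin 0 {0}ᶜ) :=
    tendsto_nhdsWithin_iff.mpr ⟨(Complex.continuous_ofReal.tendsto' 0 0 rfl).mono_left
      nhdsWithin_le_nhds, eventually_mem_nhdsWithin.mono fun x hx => by simpa using hx⟩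
  have heq := AnalyticOnNhd.eq_of_frequently_eq
    (fun w _ => (hf.differentiable_sliceRestrict hK).analyticAt w)
    (fun w _ => (hg.differentiable_sliceRestrict hK).analyticAt w)
    (hofReal.frequently (Filter.Eventually.of_forall hreal).frequently)
  exact (toSlice hK).injective (congrFun heq z)

end SliceRegularity

section QuaternionicTransform

variable {ν : ℝ} {I : ℍ} {φ ψ : ℝ → ℍ}

theorem transform_eq_bargmannTransform (ν : ℝ) (ψ : ℝ → ℍ) :
    transform ν ψ = bargmannTransform ν ψ := rfl

theorem memLp_toSlice_iff {α : Type*} [MeasurableSpace α] {μ : Measure α} {p : ℝ≥0∞}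
    {u : α → ℍ} (hI : I ^ 2 = -1) :
    MemLp (fun x => toSlice hI (u x)) p μ ↔ MemLp u p μ :=
  (toSlice hI).lipschitz.memLp_comp_iff_of_antilipschitz (toSlice hI).antilipschitz (map_zero _)

theorem eLpNorm_toSlice {α : Type*} [MeasurableSpace α] (μ : Measure α) (p : ℝ≥0∞)
    (u : α → ℍ) (hI : I ^ 2 = -1) :
    eLpNorm (fun x => toSlice hI (u x)) p μ = eLpNorm u p μ :=
  eLpNorm_congr_norm_ae (.of_forall fun x => (toSlice hI).norm_map (u x))

theorem sliceRestrict_transform (hI : I ^ 2 = -1) (ν : ℝ) (ψ : ℝ → ℍ) :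
    sliceRestrict hI (transform ν ψ) = bargmannTransform ν fun x => toSlice hI (ψ x) := by
  funext z
  have hkernel (x : ℝ) : toSlice hI (kernel ν (sliceEmbedding hI z) x * ψ x)
      = bargmannKernel ν z x • toSlice hI (ψ x) := by
    rw [← toSlice_mul, map_bargmannKernel _ (continuous_sliceEmbedding hI)]
    rfl
  rw [bargmannTransform, ← integral_congr_ae (.of_forall hkernel)]
  exact ((toSlice hI).toContinuousLinearEquiv.integral_comp_comm _).symm

theorem sliceRegular_transform (hν : 0 < ν) (hψ : MemLp ψ 2) : SliceRegular (transform ν ψ) :=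
  sliceRegular_iff.mpr
    ⟨transform_eq_bargmannTransform ν ψ ▸ differentiable_bargmannTransform ℝ hν hψ, fun I hI => by
      rw [sliceRestrict_transform]
      exact differentiable_bargmannTransform (𝔸 := ℂ) ℂ hν ((memLp_toSlice_iff hI).mpr hψ)⟩

theorem transform_mul_const (hν : 0 < ν) (hψ : MemLp ψ 2) (c : ℍ) :
    transform ν (fun x => ψ x * c) = fun q => transform ν ψ q * c := by
  funext q
  simp only [transform, ← mul_assoc]
  exact integral_mul_const_of_integrable (integrable_bargmannKernel_smul hν hψ q)

end QuaternionicTransform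

section FockSpace

variable {ν : ℝ} {I : ℍ} {f : ℍ → ℍ} {ψ : ℝ → ℍ}

theorem weight_eq (hI : I ^ 2 = -1) (ν : ℝ) (p : ℝ × ℝ) :
    weight ν I p = Real.exp (-ν * ‖Complex.equivRealProdCLM.symm p‖ ^ 2) := by
  rw [weight, ← norm_sliceEmbedding hI, sliceEmbedding_apply]
  rfl

theorem integrable_weight_smul_iff {E : Type*} [NormedAddCommGroup E] [NormedSpace ℝ E]
    (hI : I ^ 2 = -1) {u : ℂ → E} :
    Integrable (fun p => weight ν I p • u (Complex.equivRealProdCLM.symm p)) ↔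
      Integrable u (gaussianVolume ν) := by
  rw [integrable_gaussianVolume_iff,
    ← Complex.volume_preserving_equiv_real_prod.symm.integrable_comp_emb
      Complex.measurableEquivRealProd.symm.measurableEmbedding]
  simp only [weight_eq hI]
  rfl

theorem integral_weight_smul {E : Type*} [NormedAddCommGroup E] [NormedSpace ℝ E]
    (hI : I ^ 2 = -1) (ν : ℝ) (u : ℂ → E) :
    ∫ p, weight ν I p • u (Complex.equivRealProdCLM.symm p) = ∫ z, u z ∂gaussianVolume ν := by
  rw [integral_gaussianVolume, ← Complex.volume_preserving_equiv_real_prod.symm.integral_comp']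
  simp only [weight_eq hI]
  rfl

theorem mem_fockSpace_iff (hI : I ^ 2 = -1) :
    f ∈ fockSpace ν I ↔
      SliceRegular f ∧ MemLp (fun z => f (sliceEmbedding hI z)) 2 (gaussianVolume ν) := by
  refine and_congr_right fun hf => ?_
  have hcont : Continuous fun z => f (sliceEmbedding hI z) :=
    hf.differentiable.continuous.comp (continuous_sliceEmbedding hI)
  rw [memLp_two_iff_integrable_sq_norm hcont.aestronglyMeasurable, ← integrable_weight_smul_iff hI]
  simp only [sliceFun_eq hI, smul_eq_mul, mul_comm]

theorem fockNorm_eq (hI : I ^ 2 = -1)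
    (hf : AEStronglyMeasurable (fun z => f (sliceEmbedding hI z)) (gaussianVolume ν)) :
    fockNorm ν I f
      = (eLpNorm (fun z => f (sliceEmbedding hI z)) 2 (gaussianVolume ν)).toReal := by
  rw [fockNorm, toReal_eLpNorm hf, lpNorm_eq_integral_norm_rpow_toReal two_ne_zero
    ENNReal.ofNat_ne_top hf, ← integral_weight_smul hI, Real.sqrt_eq_rpow]
  simp [sliceFun_eq hI, mul_comm]

theorem fockInner_eq (hI : I ^ 2 = -1) (ν : ℝ) (f g : ℍ → ℍ) :
    fockInner ν I f g
      = ∫ z, star (g (sliceEmbedding hI z)) * f (sliceEmbedding hI z) ∂gaussianVolume ν := by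
  rw [← integral_weight_smul hI]
  simp only [fockInner, sliceFun_eq hI]

theorem eLpNorm_transform_sliceEmbedding (hI : I ^ 2 = -1) (hν : 0 < ν) (hψ : MemLp ψ 2) :
    eLpNorm (fun z => transform ν ψ (sliceEmbedding hI z)) 2 (gaussianVolume ν) = eLpNorm ψ 2 := by
  rw [← eLpNorm_toSlice _ _ _ hI, ← eLpNorm_toSlice _ _ _ hI,
    ← eLpNorm_bargmannTransform hν ((memLp_toSlice_iff hI).mpr hψ), ← sliceRestrict_transform]
  rfl

theorem memLp_transform_sliceEmbedding (hI : I ^ 2 = -1) (hν : 0 < ν) (hψ : MemLp ψ 2) :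
    MemLp (fun z => transform ν ψ (sliceEmbedding hI z)) 2 (gaussianVolume ν) :=
  ⟨((sliceRegular_transform hν hψ).differentiable.continuous.comp
    (continuous_sliceEmbedding hI)).aestronglyMeasurable,
    (eLpNorm_transform_sliceEmbedding hI hν hψ).trans_lt hψ.2⟩

theorem fockNorm_transform (hI : I ^ 2 = -1) (hν : 0 < ν) (hψ : MemLp ψ 2) :
    fockNorm ν I (transform ν ψ) = (eLpNorm ψ 2).toReal := by
  rw [fockNorm_eq hI (memLp_transform_sliceEmbedding hI hν hψ).1,
    eLpNorm_transform_sliceEmbedding hI hν hψ]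

theorem transform_mem_fockSpace (hI : I ^ 2 = -1) (hν : 0 < ν) (hψ : MemLp ψ 2) :
    transform ν ψ ∈ fockSpace ν I :=
  (mem_fockSpace_iff hI).mpr
    ⟨sliceRegular_transform hν hψ, memLp_transform_sliceEmbedding hI hν hψ⟩

theorem exists_transform_eq (hI : I ^ 2 = -1) (hν : 0 < ν) (hf : f ∈ fockSpace ν I) :
    ∃ ψ : ℝ → ℍ, MemLp ψ 2 ∧ transform ν ψ = f := by
  obtain ⟨hreg, hmem⟩ := (mem_fockSpace_iff hI).mp hf
  obtain ⟨χ, hχ, hχf⟩ := exists_bargmannTransform_eq hν (hreg.differentiable_sliceRestrict hI)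
    ((memLp_toSlice_iff hI).mpr hmem)
  have hψ : MemLp (fun x => (toSlice hI).symm (χ x)) 2 := (memLp_toSlice_iff hI).mp hχ
  refine ⟨_, hψ, (sliceRegular_transform hν hψ).eq_of_forall_real hreg fun x => ?_⟩
  have hslice := (sliceRestrict_transform hI ν fun x => (toSlice hI).symm (χ x)).trans hχf
  rw [← sliceEmbedding_ofReal hI]
  exact (toSlice hI).injective (congrFun hslice x)

end FockSpace

section Polarization

variable {α β : Type*} [MeasurableSpace α] [MeasurableSpace β] {μ : Measure α} {μ' : Measure β}

theorem integral_inner_eq_eLpNorm {E : Type*} [NormedAddCommGroup E] [InnerProductSpace ℝ E]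
    {u v : α → E} (hu : MemLp u 2 μ) (hv : MemLp v 2 μ) :
    ∫ x, inner ℝ (u x) (v x) ∂μ
      = ((eLpNorm (u + v) 2 μ).toReal ^ 2 - (eLpNorm (u - v) 2 μ).toReal ^ 2) / 4 := by
  have hinner : ∫ x, inner ℝ (u x) (v x) ∂μ = inner ℝ (hu.toLp u) (hv.toLp v) := by
    rw [L2.inner_def]
    refine integral_congr_ae ?_
    filter_upwards [hu.coeFn_toLp, hv.coeFn_toLp] with x hux hvx
    rw [hux, hvx]
  rw [hinner, ← Lp.norm_toLp _ (hu.add hv), ← Lp.norm_toLp _ (hu.sub hv), MemLp.toLp_add hu hv,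
    MemLp.toLp_sub hu hv, pow_two, pow_two]
  exact re_inner_eq_norm_add_mul_self_sub_norm_sub_mul_self_div_four (𝕜 := ℝ)
    (hu.toLp u) (hv.toLp v)

theorem inner_star_mul (a b c : ℍ) : inner ℝ c (star b * a) = inner ℝ a (b * c) := by
  simp [Quaternion.inner_def]
  ring

theorem inner_integral_star_mul {u v : α → ℍ} (hu : MemLp u 2 μ) (hv : MemLp v 2 μ) (c : ℍ) :
    inner ℝ c (∫ x, star (v x) * u x ∂μ) = ∫ x, inner ℝ (u x) (v x * c) ∂μ := by
  have hint : Integrable (fun x => star (v x) * u x) μ :=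
    memLp_one_iff_integrable.mp (hu.mul (r := 1) hv.star)
  simp only [← integral_inner hint, inner_star_mul]

theorem integral_star_mul_eq_of_eLpNorm_eq {u v : α → ℍ} {u' v' : β → ℍ} (hu : MemLp u 2 μ)
    (hv : MemLp v 2 μ) (hu' : MemLp u' 2 μ') (hv' : MemLp v' 2 μ')
    (h : ∀ c : ℍ, eLpNorm (fun x => u x + v x * c) 2 μ = eLpNorm (fun x => u' x + v' x * c) 2 μ') :
    ∫ x, star (v x) * u x ∂μ = ∫ x, star (v' x) * u' x ∂μ' := by
  refine ext_inner_left ℝ fun c => ?_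
  have hneg := h (-c)
  simp only [mul_neg, ← sub_eq_add_neg] at hneg
  rw [inner_integral_star_mul hu hv, inner_integral_star_mul hu' hv',
    integral_inner_eq_eLpNorm hu (hv.mul_const c), integral_inner_eq_eLpNorm hu' (hv'.mul_const c)]
  exact congrArg₂ (fun a b : ℝ≥0∞ => (a.toReal ^ 2 - b.toReal ^ 2) / 4)
    (h c) hneg

end Polarization

section Unitarity

variable {ν : ℝ} {I : ℍ} {φ ψ : ℝ → ℍ}

theorem fockInner_transform (hI : I ^ 2 = -1) (hν : 0 < ν) (hφ : MemLp φ 2) (hψ : MemLp ψ 2) :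
    fockInner ν I (transform ν φ) (transform ν ψ) = ∫ x, star (ψ x) * φ x := by
  rw [fockInner_eq hI]
  refine integral_star_mul_eq_of_eLpNorm_eq (memLp_transform_sliceEmbedding hI hν hφ)
    (memLp_transform_sliceEmbedding hI hν hψ) hφ hψ fun c => ?_
  have htransform : transform ν (φ + fun x => ψ x * c)
      = transform ν φ + fun q => transform ν ψ q * c := by
    rw [← transform_mul_const hν hψ]
    simp only [transform_eq_bargmannTransform]
    exact bargmannTransform_add hν hφ (hψ.mul_const c)
  have hnorm := eLpNorm_transform_sliceEmbedding hI hν (hφ.add (hψ.mul_const c))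
  rw [htransform] at hnorm
  exact hnorm

/-- The quaternionic Segal-Bargmann transform as a right `ℍ`-linear map into the Fock space. -/
noncomputable def transformLinearMap (hI : I ^ 2 = -1) (hν : 0 < ν) :
    Lp ℍ 2 (volume : Measure ℝ) →ₗ[ℍᵐᵒᵖ] fockSpace ν I where
  toFun ψ := ⟨transform ν ψ, transform_mem_fockSpace hI hν (Lp.memLp ψ)⟩
  map_add' φ ψ := Subtype.ext <|
    (funext (bargmannTransform_congr_ae (Lp.coeFn_add φ ψ) ν)).trans
      (bargmannTransform_add hν (Lp.memLp φ) (Lp.memLp ψ))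
  map_smul' c ψ := Subtype.ext <|
    (funext (bargmannTransform_congr_ae (Lp.coeFn_smul c ψ) ν)).trans
      (transform_mul_const hν (Lp.memLp ψ) c.unop)

theorem transformLinearMap_bijective (hI : I ^ 2 = -1) (hν : 0 < ν) :
    Function.Bijective (transformLinearMap hI hν) := by
  constructor
  · refine (injective_iff_map_eq_zero _).mpr fun ψ hψ => ?_
    have hzero : transform ν ψ = 0 := congrArg Subtype.val hψ
    have hnorm := fockNorm_transform hI hν (Lp.memLp ψ)
    rw [hzero, ← Lp.norm_def] at hnorm
    rw [← norm_eq_zero, ← hnorm]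
    simp [fockNorm, sliceFun]
  · rintro ⟨f, hf⟩
    obtain ⟨ψ, hψ, rfl⟩ := exists_transform_eq hI hν hf
    exact ⟨hψ.toLp ψ, Subtype.ext (funext (bargmannTransform_congr_ae hψ.coeFn_toLp ν))⟩

end Unitarity

end QuaternionicSegalBargmann

/-- For every slice `ℂ_I`, the integral defining `B_ν ψ (q)` converges for all `ψ ∈ L²(ℝ; ℍ)` and
`q ∈ ℍ`, and `B_ν` is a right `ℍ`-linear bijection of `L²(ℝ; ℍ)` onto the slice hyperholomorphic
Bargmann-Fock space which preserves the norm and the `ℍ`-valued inner product. -/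
theorem mainTheorem1 (ν : ℝ) (hν : 0 < ν) (I : ℍ) (hI : I ^ 2 = -1) :
    (∀ (ψ : Lp ℍ 2 (volume : Measure ℝ)) (q : ℍ),
      Integrable (fun x : ℝ => QuaternionicSegalBargmann.kernel ν q x * ψ x)) ∧
    ∃ U : Lp ℍ 2 (volume : Measure ℝ) ≃ₗ[ℍᵐᵒᵖ] QuaternionicSegalBargmann.fockSpace ν I,
      (∀ ψ : Lp ℍ 2 (volume : Measure ℝ),
        (U ψ : ℍ → ℍ) = QuaternionicSegalBargmann.transform ν ψ) ∧
      (∀ ψ : Lp ℍ 2 (volume : Measure ℝ),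
        QuaternionicSegalBargmann.fockNorm ν I (U ψ) = ‖ψ‖) ∧
      (∀ φ ψ : Lp ℍ 2 (volume : Measure ℝ),
        QuaternionicSegalBargmann.fockInner ν I (U φ) (U ψ) = ∫ x : ℝ, star (ψ x) * φ x) := by
  refine ⟨fun ψ q => QuaternionicSegalBargmann.integrable_bargmannKernel_smul hν (Lp.memLp ψ) q,
    LinearEquiv.ofBijective _ (QuaternionicSegalBargmann.transformLinearMap_bijective hI hν),
    fun ψ => rfl, fun ψ => ?_, fun φ ψ => ?_⟩
  · exact (QuaternionicSegalBargmann.fockNorm_transform hI hν (Lp.memLp ψ)).trans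
      (Lp.norm_def ψ).symm
  · exact QuaternionicSegalBargmann.fockInner_transform hI hν (Lp.memLp φ) (Lp.memLp ψ)
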